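/- Let $0<\mu<\bar v$, and let $\mathcal F$ be the set of all probability distributions $F$ on $[0,\bar v]$ with mean at least $\mu$. An $n$-level pricing mechanism consists of prices $0\le v_1\le\dots\le v_n\le\bar v$ and probabilities $x_1,\dots,x_n\ge 0$ with $\sum_i x_i=1$; a buyer with valuation $v$ pays in expectation $\sum_{i:\,v_i\le v}x_iv_i$. Its competitive ratio is $$\inf_{F\in\mathcal F}\ \frac{\int \sum_{i:\,v_i\le v}x_iv_i\,dF(v)}{\max_{p\in[0,\bar v]}\,p\,\mathbb P_{V\sim F}[V\ge p]},$$ and an $n$-level mechanism is optimal if it maximizes the competitive ratio among all $n$-level mechanisms. Let $\mathcal R_2^*$ be the supremum of the competitive ratios of the 2-level mechanisms, and put $v_1=\bar v-\sqrt{\bar v^2-\mu\bar v}$. There is an absolute constant $\tau\in(0.4902,\,0.4903)$ such that for all $0<\mu<\bar v$ the following hold. The price $v_1$ is the unique optimal price of 1-level pricing, and every optimal 2-level mechanism has lower price $v_1$. Moreover: 1. If $\mu/\bar v\le\tau$, then the mechanism with lower price $v_1$ and $$v_2=\sqrt{v_1\bar v},\qquad x_1=\frac{1}{2-\sqrt{v_1/\bar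 v}},\qquad x_2=1-x_1$$ is an optimal 2-level mechanism, and $\mathcal R_2^*=\dfrac{1}{2\sqrt{\bar v/v_1}-1}$. 2. If $\mu/\bar v\ge\tau$, then, with $v_2=\dfrac{v_1+\sqrt{v_1^2+8v_1\bar v}}{4}$ and $D=(v_2-v_1)(2v_2\bar v-v_2^2-\mu\bar v)+v_1\bar v(\bar v-\mu)>0$, the mechanism with prices $v_1,v_2$ and probabilities $$x_1=\frac{v_2(2v_2\bar v-v_2^2-\mu\bar v)}{D},\qquad x_2=1-x_1$$ is an optimal 2-level mechanism, and $\mathcal R_2^*=\dfrac{v_1v_2(\bar v-\mu)}{D}$. In each case, when the inequality between $\mu/\bar v$ and $\tau$ is strict, the optimal 2-level mechanism is unique. -/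

import Mathlib

open MeasureTheory

noncomputable section

namespace RobustPricing

/-- An `n`-level pricing mechanism on the valuation space `[0, vbar]`: prices
`price 0 ≤ ⋯ ≤ price (n - 1)` in `[0, vbar]`, the price `price i` being posted with probability
`prob i`. -/
@[ext]
structure LevelPricing (n : ℕ) (vbar : ℝ) where
  price : Fin n → ℝ
  prob : Fin n → ℝ
  price_mono : Monotone price
  price_mem : ∀ i, price i ∈ Set.Icc 0 vbar
  prob_nonneg : ∀ i, 0 ≤ prob i
  prob_sum : ∑ i, prob i = 1

/-- Expected payment of a buyer with valuation `v`, who buys exactly when the realized price is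
at most `v`. -/
def LevelPricing.payment {n : ℕ} {vbar : ℝ} (m : LevelPricing n vbar) (v : ℝ) : ℝ :=
  ∑ i, if m.price i ≤ v then m.prob i * m.price i else 0

/-- Expected revenue of the mechanism when the valuation has law `F`. -/
def LevelPricing.revenue {n : ℕ} {vbar : ℝ} (m : LevelPricing n vbar) (F : Measure ℝ) : ℝ :=
  ∫ v, m.payment v ∂F

/-- Hindsight optimal revenue `max_{p ∈ [0, vbar]} p * P(V ≥ p)` for the valuation law `F`. -/
def optRevenue (vbar : ℝ) (F : Measure ℝ) : ℝ :=
  ⨆ p : Set.Icc (0 : ℝ) vbar, (p : ℝ) * F.real (Set.Ici (p : ℝ))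

/-- The mean ambiguity set: probability measures on `[0, vbar]` with mean at least `μ`. -/
def meanAmbiguitySet (vbar μ : ℝ) : Set (Measure ℝ) :=
  {F | IsProbabilityMeasure F ∧ F (Set.Icc 0 vbar)ᶜ = 0 ∧ μ ≤ ∫ v, v ∂F}

/-- Competitive ratio of the mechanism over the mean ambiguity set. -/
def LevelPricing.competitiveRatio {n : ℕ} {vbar : ℝ} (m : LevelPricing n vbar) (μ : ℝ) : ℝ :=
  ⨅ F : meanAmbiguitySet vbar μ, m.revenue F.1 / optRevenue vbar F.1

/-- `m` maximizes the competitive ratio among all `n`-level pricing mechanisms. -/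
def LevelPricing.IsOptimal {n : ℕ} {vbar : ℝ} (m : LevelPricing n vbar) (μ : ℝ) : Prop :=
  ∀ m' : LevelPricing n vbar, m'.competitiveRatio μ ≤ m.competitiveRatio μ

/-- The optimal competitive ratio of `n`-level pricing over the mean ambiguity set. -/
def optimalRatio (n : ℕ) (vbar μ : ℝ) : ℝ :=
  ⨆ m : LevelPricing n vbar, m.competitiveRatio μ

/-- The price `v̄ - √(v̄² - μ v̄)`. -/
def lowPrice (vbar μ : ℝ) : ℝ :=
  vbar - √(vbar ^ 2 - μ * vbar)

/-- The higher price `(v₁ + √(v₁² + 8 v₁ v̄)) / 4` of the second regime, `v₁ = lowPrice vbar μ`. -/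
def highPrice (vbar μ : ℝ) : ℝ :=
  (lowPrice vbar μ + √(lowPrice vbar μ ^ 2 + 8 * lowPrice vbar μ * vbar)) / 4

/-- The common denominator `(v₂ - v₁)(2 v₂ v̄ - v₂² - μ v̄) + v₁ v̄ (v̄ - μ)` of the second regime. -/
def denom (vbar μ v₁ v₂ : ℝ) : ℝ :=
  (v₂ - v₁) * (2 * v₂ * vbar - v₂ ^ 2 - μ * vbar) + v₁ * vbar * (vbar - μ)

end RobustPricing

end

noncomputable section

namespace RobustPricing

/-! Measure values in units of `v̄` and put `t = v₁/v̄`, `M = μ/v̄`, so that `M = 2t - t²`. Let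
`k_r` be the least mass at 1 that lifts the mean to `M` when the remaining mass sits at `r`. For
prices `P < Q` with probabilities `x, y`, the point mass at 1 and the two-point laws with lower atom
just below `Q` or `P` bound the ratio `ρ`: (A) `ρ ≤ xP + yQ`, (B) `ρQ ≤ xP + k_Q yQ`, (C) `ρP ≤ k_P
(xP + yQ)`. Since `k_t = t`, (A) and (C) coincide at `P = t`. For a single price these bounds
already single out `t`; for two prices, moving `P` away from `t` in either direction strictly lowers
the attainable `ρ`.

At `P = t` the combination `(Q - t)(B) + (t - k_Q Q)(A)` eliminates the probabilities and gives `t/ρ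
≥ ((Q - t)Q + t - k_Q Q) / (Q(1 - k_Q))`. For `Q ≥ M` one has `k_Q = 0`, and the right side is at
least its value at `√t`; for `Q < M` it is a cubic over a multiple of `Q`, bounded below by its
value at `w` with `2w² = t(1 + w)`. These two candidates are the two regimes. With `√t = 2c - 1/c`
and `w = √t c` their comparison is the sign of a quintic in `c`, whose root defines `τ`.
`two_level_bound` carries this half, with equality cases that yield uniqueness.

Conversely, probabilities that make (A) and (B) equalities guarantee `ρ` against every law and every
posted price (`LevelPricing.le_ratio_two`). -/

/-! ### Tail probabilities, revenue and the mean constraint -/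

lemma real_tail_le_one {F : Measure ℝ} [IsProbabilityMeasure F] (r : ℝ) :
    F.real (Set.Ici r) ≤ 1 := measureReal_le_one

lemma real_tail_anti {F : Measure ℝ} [IsProbabilityMeasure F] {r s : ℝ} (h : r ≤ s) :
    F.real (Set.Ici s) ≤ F.real (Set.Ici r) :=
  measureReal_mono (Set.Ici_subset_Ici.2 h)

lemma ae_mem_Icc {b : ℝ} {F : Measure ℝ} (h : F (Set.Icc 0 b)ᶜ = 0) :
    ∀ᵐ v ∂F, v ∈ Set.Icc 0 b := h

lemma integrable_tail_indicator {F : Measure ℝ} [IsProbabilityMeasure F] (p a : ℝ) :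
    Integrable ((Set.Ici p).indicator fun _ : ℝ => a) F :=
  (integrable_const a).indicator measurableSet_Ici

lemma integral_tail_indicator {F : Measure ℝ} (p a : ℝ) :
    ∫ v, (Set.Ici p).indicator (fun _ : ℝ => a) v ∂F = F.real (Set.Ici p) * a := by
  rw [integral_indicator_const a measurableSet_Ici, smul_eq_mul]

lemma LevelPricing.revenue_eq {n : ℕ} {b : ℝ} (m : LevelPricing n b) (F : Measure ℝ)
    [IsProbabilityMeasure F] :
    m.revenue F = ∑ i, m.prob i * m.price i * F.real (Set.Ici (m.price i)) := by
  have h : ∀ v, m.payment v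
      = ∑ i, (Set.Ici (m.price i)).indicator (fun _ : ℝ => m.prob i * m.price i) v := by
    intro v
    simp only [LevelPricing.payment, Set.indicator, Set.mem_Ici]
  simp only [LevelPricing.revenue, h]
  rw [integral_finsetSum _ fun i _ => integrable_tail_indicator _ _]
  exact Finset.sum_congr rfl fun i _ => by rw [integral_tail_indicator]; ring

lemma LevelPricing.revenue_nonneg {n : ℕ} {b : ℝ} (m : LevelPricing n b) (F : Measure ℝ) :
    0 ≤ m.revenue F :=
  integral_nonneg fun v => Finset.sum_nonneg fun i _ => by
    split_ifs
    · exact mul_nonneg (m.prob_nonneg i) (m.price_mem i).1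
    · exact le_rfl

lemma optRevenue_nonneg (b : ℝ) (F : Measure ℝ) : 0 ≤ optRevenue b F :=
  Real.iSup_nonneg fun p => mul_nonneg p.2.1 measureReal_nonneg

lemma le_optRevenue {b r : ℝ} {F : Measure ℝ} [IsProbabilityMeasure F] (hr : r ∈ Set.Icc 0 b) :
    r * F.real (Set.Ici r) ≤ optRevenue b F := by
  refine le_ciSup (f := fun p : Set.Icc (0 : ℝ) b => (p : ℝ) * F.real (Set.Ici (p : ℝ)))
    ⟨b, ?_⟩ ⟨r, hr⟩
  rintro _ ⟨p, rfl⟩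
  calc (p : ℝ) * F.real (Set.Ici (p : ℝ)) ≤ p * 1 :=
        mul_le_mul_of_nonneg_left measureReal_le_one p.2.1
    _ ≤ b := by rw [mul_one]; exact p.2.2

/-- The mean is bounded by the tail probabilities at two thresholds. -/
lemma mean_le_tails {b μ p q : ℝ} {F : Measure ℝ} (hF : F ∈ meanAmbiguitySet b μ)
    (hpq : p ≤ q) :
    μ ≤ p + (q - p) * F.real (Set.Ici p) + (b - q) * F.real (Set.Ici q) := by
  obtain ⟨hprob, hsupp, hmean⟩ := hF
  refine hmean.trans ?_
  -- On `[0, b]` the identity lies below the step function with values `p`, `q`, `b` and jumps at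
  -- `p` and `q`.
  have h1 : ∫ v, v ∂F ≤ ∫ v, (p + ((Set.Ici p).indicator (fun _ : ℝ => q - p) v
      + (Set.Ici q).indicator (fun _ : ℝ => b - q) v)) ∂F := by
    refine integral_mono_of_nonneg ?_ ((integrable_const _).add
      ((integrable_tail_indicator _ _).add (integrable_tail_indicator _ _))) ?_
    · filter_upwards [ae_mem_Icc hsupp] with v hv using hv.1
    · filter_upwards [ae_mem_Icc hsupp] with v hv
      have := hv.2
      simp only [Set.indicator, Set.mem_Ici]
      split_ifs <;> linarith
  have i1 := integrable_tail_indicator (F := F) p (q - p)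
  have i2 := integrable_tail_indicator (F := F) q (b - q)
  have i3 : Integrable (fun v => (Set.Ici p).indicator (fun _ : ℝ => q - p) v
      + (Set.Ici q).indicator (fun _ : ℝ => b - q) v) F := i1.add i2
  rw [integral_add (integrable_const _) i3, integral_add i1 i2, integral_tail_indicator,
    integral_tail_indicator] at h1
  simp only [integral_const, probReal_univ, smul_eq_mul, one_mul] at h1
  linarith

lemma optRevenue_pos {b μ : ℝ} {F : Measure ℝ} (hμ : 0 < μ) (hμb : μ < b)
    (hF : F ∈ meanAmbiguitySet b μ) : 0 < optRevenue b F := by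
  have := hF.1
  have h := mean_le_tails hF (le_refl (μ / 2))
  have hS : 0 < F.real (Set.Ici (μ / 2)) := by
    by_contra hS
    have : F.real (Set.Ici (μ / 2)) = 0 := le_antisymm (not_lt.1 hS) measureReal_nonneg
    rw [this] at h
    linarith
  exact (mul_pos (half_pos hμ) hS).trans_le (le_optRevenue ⟨by linarith, by linarith⟩)

lemma LevelPricing.competitiveRatio_le {n : ℕ} {b μ : ℝ} (m : LevelPricing n b) {F : Measure ℝ}
    (hF : F ∈ meanAmbiguitySet b μ) :
    m.competitiveRatio μ ≤ m.revenue F / optRevenue b F := by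
  refine ciInf_le (f := fun F : meanAmbiguitySet b μ => m.revenue F.1 / optRevenue b F.1)
    ⟨0, ?_⟩ ⟨F, hF⟩
  rintro _ ⟨F, rfl⟩
  exact div_nonneg (m.revenue_nonneg _) (optRevenue_nonneg _ _)

lemma LevelPricing.competitiveRatio_nonneg {n : ℕ} {b μ : ℝ} (m : LevelPricing n b) :
    0 ≤ m.competitiveRatio μ :=
  Real.iInf_nonneg fun _ => div_nonneg (m.revenue_nonneg _) (optRevenue_nonneg _ _)

lemma LevelPricing.competitiveRatio_mul_le {n : ℕ} {b μ r : ℝ} (m : LevelPricing n b)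
    {F : Measure ℝ} (hμ : 0 < μ) (hμb : μ < b) (hF : F ∈ meanAmbiguitySet b μ)
    (hr : r ∈ Set.Icc 0 b) :
    m.competitiveRatio μ * (r * F.real (Set.Ici r)) ≤ m.revenue F := by
  have := hF.1
  have h := m.competitiveRatio_le hF
  rw [le_div_iff₀ (optRevenue_pos hμ hμb hF)] at h
  exact (mul_le_mul_of_nonneg_left (le_optRevenue hr) m.competitiveRatio_nonneg).trans h

/-! ### Two-point laws and upper bounds on the ratio -/

/-- The two-point law `(1 - c) δ_r + c δ_b`. -/
def twoPoint (b r c : ℝ) : Measure ℝ :=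
  ENNReal.ofReal (1 - c) • Measure.dirac r + ENNReal.ofReal c • Measure.dirac b

lemma isProbabilityMeasure_twoPoint {b r c : ℝ} (h0 : 0 ≤ c) (h1 : c ≤ 1) :
    IsProbabilityMeasure (twoPoint b r c) :=
  ⟨by simp [twoPoint, ← ENNReal.ofReal_add (sub_nonneg.2 h1) h0]⟩

lemma integral_twoPoint {b r c : ℝ} (h0 : 0 ≤ c) (h1 : c ≤ 1) (f : ℝ → ℝ) :
    ∫ v, f v ∂(twoPoint b r c) = (1 - c) * f r + c * f b := by
  have hi : ∀ a x : ℝ, Integrable f (ENNReal.ofReal a • Measure.dirac x) := fun a x =>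
    (integrable_dirac (by simp)).smul_measure ENNReal.ofReal_ne_top
  rw [twoPoint, integral_add_measure (hi _ _) (hi _ _), integral_smul_measure,
    integral_smul_measure, integral_dirac, integral_dirac,
    ENNReal.toReal_ofReal (sub_nonneg.2 h1), ENNReal.toReal_ofReal h0, smul_eq_mul, smul_eq_mul]

lemma twoPoint_mem {b μ r c : ℝ} (h0 : 0 ≤ c) (h1 : c ≤ 1) (hr : r ∈ Set.Icc 0 b)
    (hmean : μ ≤ (1 - c) * r + c * b) : twoPoint b r c ∈ meanAmbiguitySet b μ := by
  refine ⟨isProbabilityMeasure_twoPoint h0 h1, ?_, ?_⟩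
  · have hb : b ∈ Set.Icc 0 b := ⟨hr.1.trans hr.2, le_rfl⟩
    have hm : MeasurableSet (Set.Icc 0 b)ᶜ := measurableSet_Icc.compl
    simp only [twoPoint, Measure.add_apply, Measure.smul_apply, Measure.dirac_apply' _ hm]
    simp [hr.1, hr.2, hb.1]
  · rwa [integral_twoPoint h0 h1 fun v => v]

lemma twoPoint_tail {b r c : ℝ} (h0 : 0 ≤ c) (h1 : c ≤ 1) (hr : r ≤ b) :
    (twoPoint b r c).real (Set.Ici r) = 1 := by
  have h := integral_twoPoint (b := b) (r := r) h0 h1 ((Set.Ici r).indicator fun _ => (1 : ℝ))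
  rw [integral_tail_indicator] at h
  simp [Set.indicator, hr] at h
  exact h

lemma LevelPricing.ratio_mul_le_twoPoint {n : ℕ} {b μ r c : ℝ} (m : LevelPricing n b)
    (hμ : 0 < μ) (hμb : μ < b) (h0 : 0 ≤ c) (h1 : c ≤ 1) (hr : r ∈ Set.Icc 0 b)
    (hmean : μ ≤ (1 - c) * r + c * b) :
    m.competitiveRatio μ * r ≤ (1 - c) * m.payment r + c * m.payment b := by
  have h := m.competitiveRatio_mul_le hμ hμb (twoPoint_mem h0 h1 hr hmean) hr
  rwa [twoPoint_tail h0 h1 hr.2, mul_one, LevelPricing.revenue, integral_twoPoint h0 h1] at h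

lemma LevelPricing.payment_top {n : ℕ} {b : ℝ} (m : LevelPricing n b) :
    m.payment b = ∑ i, m.prob i * m.price i :=
  Finset.sum_congr rfl fun i _ => if_pos (m.price_mem i).2

lemma LevelPricing.ratio_mul_le_top {n : ℕ} {b μ : ℝ} (m : LevelPricing n b)
    (hμ : 0 < μ) (hμb : μ < b) :
    m.competitiveRatio μ * b ≤ m.payment b := by
  have h := m.ratio_mul_le_twoPoint (r := b) (c := 1) hμ hμb zero_le_one le_rfl
    ⟨by linarith, le_rfl⟩ (by linarith)
  linarith

/-- The smallest mass at `b` which lifts the mean to `μ` when the rest of the mass sits at `r`. -/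
def topMass (b μ r : ℝ) : ℝ := max 0 ((μ - r) / (b - r))

lemma topMass_nonneg (b μ r : ℝ) : 0 ≤ topMass b μ r := le_max_left _ _

lemma topMass_of_le {b μ r : ℝ} (hμb : μ ≤ b) (h : r ≤ μ) :
    topMass b μ r = (μ - r) / (b - r) :=
  max_eq_right (div_nonneg (by linarith) (by linarith))

lemma topMass_of_ge {b μ r : ℝ} (hr : r ≤ b) (h : μ ≤ r) : topMass b μ r = 0 :=
  max_eq_left (div_nonpos_of_nonpos_of_nonneg (by linarith) (by linarith))

lemma LevelPricing.ratio_mul_le_topMass {n : ℕ} {b μ r : ℝ} (m : LevelPricing n b)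
    (hμ : 0 < μ) (hμb : μ < b) (h0 : 0 ≤ r) (hr : r < b) :
    m.competitiveRatio μ * r
      ≤ (1 - topMass b μ r) * m.payment r + topMass b μ r * m.payment b := by
  have hbr : 0 < b - r := by linarith
  refine m.ratio_mul_le_twoPoint hμ hμb (topMass_nonneg _ _ _)
    (max_le zero_le_one ((div_le_one hbr).2 (by linarith))) ⟨h0, hr.le⟩ ?_
  have h : (μ - r) / (b - r) ≤ topMass b μ r := le_max_right _ _
  rw [div_le_iff₀ hbr] at h
  linarith

/-- If the payment equals `a` just below the price `q`, then the laws with atoms just below `q`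
and at `b` bound the ratio. -/
lemma LevelPricing.ratio_mul_le_below {n : ℕ} {b μ p q a : ℝ} (m : LevelPricing n b)
    (hμ : 0 < μ) (hμb : μ < b) (hp : 0 ≤ p) (hpq : p < q) (hq : q ≤ b)
    (ha : ∀ r, p ≤ r → r < q → m.payment r = a) :
    m.competitiveRatio μ * q ≤ (1 - topMass b μ q) * a + topMass b μ q * m.payment b := by
  have key : ∀ r, p ≤ r → r < q → m.competitiveRatio μ * r
      ≤ (1 - topMass b μ r) * a + topMass b μ r * m.payment b := fun r h1 h2 => by
    have := m.ratio_mul_le_topMass hμ hμb (hp.trans h1) (h2.trans_le hq)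
    rwa [ha r h1 h2] at this
  have hev : ∀ᶠ r in nhdsWithin q (Set.Iio q), p ≤ r ∧ r < q := by
    filter_upwards [Ioo_mem_nhdsLT hpq] with r hr using ⟨hr.1.le, hr.2⟩
  have hlim : Filter.Tendsto (fun r => topMass b μ r) (nhdsWithin q (Set.Iio q))
      (nhds (topMass b μ q)) := by
    rcases hq.lt_or_eq with hqb | rfl
    · have hc : ContinuousAt (fun r => topMass b μ r) q := by
        unfold topMass
        refine continuousAt_const.max ?_
        exact (continuousAt_const.sub continuousAt_id).div
          (continuousAt_const.sub continuousAt_id) (by simpa using (sub_pos.2 hqb).ne')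
      exact hc.tendsto.mono_left nhdsWithin_le_nhds
    -- At the top price the quotient in `topMass` has denominator zero; its value there is 0, which
    -- agrees with the left limit because `topMass` vanishes between `μ` and the top.
    · rw [topMass_of_ge le_rfl hμb.le]
      refine tendsto_const_nhds.congr' ?_
      filter_upwards [Ioo_mem_nhdsLT hμb] with r hr
      rw [topMass_of_ge hr.2.le hr.1.le]
  refine le_of_tendsto_of_tendsto
    (f := fun r => m.competitiveRatio μ * r)
    (g := fun r => (1 - topMass b μ r) * a + topMass b μ r * m.payment b)
    (b := nhdsWithin q (Set.Iio q)) ?_ ?_ (hev.mono fun r hr => key r hr.1 hr.2)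
  · exact (tendsto_const_nhds.mul Filter.tendsto_id).mono_left nhdsWithin_le_nhds
  · exact ((tendsto_const_nhds.sub hlim).mul_const _).add (hlim.mul_const _)

/-! ### Guarantees against all laws and posted prices -/

lemma diracTop_mem {b μ : ℝ} (hb : 0 ≤ b) (hμb : μ ≤ b) :
    twoPoint b b 1 ∈ meanAmbiguitySet b μ :=
  twoPoint_mem zero_le_one le_rfl ⟨hb, le_rfl⟩ (by linarith)

lemma LevelPricing.le_competitiveRatio {n : ℕ} {b μ ρ : ℝ} (m : LevelPricing n b)
    (hμ : 0 < μ) (hμb : μ < b) (hρ : 0 < ρ)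
    (h : ∀ F ∈ meanAmbiguitySet b μ, ∀ r ∈ Set.Icc 0 b,
      ρ * (r * F.real (Set.Ici r)) ≤ m.revenue F) :
    ρ ≤ m.competitiveRatio μ := by
  have : Nonempty (meanAmbiguitySet b μ) := ⟨⟨_, diracTop_mem (by linarith) hμb.le⟩⟩
  refine le_ciInf fun F => ?_
  have : Nonempty (Set.Icc (0 : ℝ) b) := ⟨⟨0, le_rfl, by linarith⟩⟩
  rw [le_div_iff₀ (optRevenue_pos hμ hμb F.2), ← le_div_iff₀' hρ]
  exact ciSup_le fun r => (le_div_iff₀' hρ).2 (h F.1 F.2 r.1 r.2)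

lemma tail_ge_of_mean {b μ q : ℝ} {F : Measure ℝ} (hF : F ∈ meanAmbiguitySet b μ) (hq : q < b) :
    (μ - q) / (b - q) ≤ F.real (Set.Ici q) := by
  have h := mean_le_tails hF (le_refl q)
  rw [div_le_iff₀ (by linarith)]
  linarith

/-- Lower bound on the ratio of a single price. -/
lemma LevelPricing.le_ratio_one {b μ : ℝ} (m : LevelPricing 1 b) (hμ : 0 < μ) (hμb : μ < b)
    (hp0 : 0 < m.price 0) (hpb : m.price 0 < b)
    (hp : μ * b = 2 * m.price 0 * b - m.price 0 ^ 2) :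
    m.price 0 / b ≤ m.competitiveRatio μ := by
  have hb : 0 < b := hp0.trans hpb
  refine m.le_competitiveRatio hμ hμb (div_pos hp0 hb) fun F hF r hr => ?_
  have := hF.1
  have hx : m.prob 0 = 1 := by simpa using m.prob_sum
  rw [m.revenue_eq, Fin.sum_univ_one, hx, one_mul]
  set p := m.price 0
  have hS := tail_ge_of_mean hF hpb
  have hpS : p ≤ b * F.real (Set.Ici p) := by
    rw [div_le_iff₀ (by linarith)] at hS
    nlinarith
  have h1 : r * F.real (Set.Ici r) ≤ b * F.real (Set.Ici p) := by
    rcases le_total p r with h | h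
    · exact mul_le_mul hr.2 (real_tail_anti h) measureReal_nonneg hb.le
    · calc r * F.real (Set.Ici r) ≤ r * 1 :=
            mul_le_mul_of_nonneg_left (real_tail_le_one r) hr.1
        _ ≤ b * F.real (Set.Ici p) := by linarith
  calc p / b * (r * F.real (Set.Ici r)) ≤ p / b * (b * F.real (Set.Ici p)) :=
        mul_le_mul_of_nonneg_left h1 (div_pos hp0 hb).le
    _ = p * F.real (Set.Ici p) := by field_simp

/-- Lower bound on the ratio of a two-level mechanism whose probabilities balance the worst
cases at `b` and just below the higher price. -/
lemma LevelPricing.le_ratio_two {b μ k ρ : ℝ} (m : LevelPricing 2 b) (hμ : 0 < μ) (hμb : μ < b)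
    (hp0 : 0 < m.price 0) (hq : m.price 1 < b)
    (hp : μ * b = 2 * m.price 0 * b - m.price 0 ^ 2)
    (hk : ∀ F ∈ meanAmbiguitySet b μ, k ≤ F.real (Set.Ici (m.price 1)))
    (hkp : k * b ≤ m.price 0) (hρ : 0 < ρ)
    (htop : m.prob 0 * m.price 0 + m.prob 1 * m.price 1 = ρ * b)
    (hbal : m.prob 0 * m.price 0 + m.prob 1 * m.price 1 * k = ρ * m.price 1) :
    ρ ≤ m.competitiveRatio μ := by
  have hpq : m.price 0 ≤ m.price 1 := m.price_mono (by decide)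
  have hx := m.prob_nonneg 0
  have hy := m.prob_nonneg 1
  refine m.le_competitiveRatio hμ hμb hρ fun F hF r hr => ?_
  have := hF.1
  have hkc := hk F hF
  have hmean := mean_le_tails hF hpq
  rw [m.revenue_eq, Fin.sum_univ_two]
  have ha1 := real_tail_le_one (F := F) (m.price 0)
  have hca := real_tail_anti (F := F) hpq
  have hc0 : 0 ≤ F.real (Set.Ici (m.price 1)) := measureReal_nonneg
  have hrp : m.price 0 ≤ r → F.real (Set.Ici r) ≤ F.real (Set.Ici (m.price 0)) := real_tail_anti
  have hrq : m.price 1 ≤ r → F.real (Set.Ici r) ≤ F.real (Set.Ici (m.price 1)) := real_tail_anti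
  have hr1 : F.real (Set.Ici r) ≤ 1 := real_tail_le_one r
  have hd0 : 0 ≤ F.real (Set.Ici r) := measureReal_nonneg
  have hr0 := hr.1
  have hrb := hr.2
  generalize F.real (Set.Ici (m.price 0)) = a at *
  generalize F.real (Set.Ici (m.price 1)) = c at *
  generalize F.real (Set.Ici r) = d at *
  generalize m.price 0 = p at *
  generalize m.price 1 = q at *
  have hX : 0 ≤ m.prob 0 * p := mul_nonneg hx hp0.le
  have hY : 0 ≤ m.prob 1 * q := mul_nonneg hy (hp0.le.trans hpq)
  generalize m.prob 0 * p = X at *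
  generalize m.prob 1 * q = Y at *
  have hb : 0 < b := hμ.trans hμb
  have ha0 : 0 ≤ a := hc0.trans hca
  rcases le_or_gt q r with h | h
  · calc ρ * (r * d) ≤ ρ * (b * c) :=
          mul_le_mul_of_nonneg_left (mul_le_mul hrb (hrq h) hd0 hb.le) hρ.le
      _ = X * c + Y * c := by rw [← add_mul, htop]; ring
      _ ≤ X * a + Y * c := by
          have := mul_le_mul_of_nonneg_left hca hX
          linarith
  rcases le_or_gt p r with h' | h'
  -- `k` may be negative: then `k * a ≤ 0 ≤ c`, while for `k ≥ 0` the bound `a ≤ 1` suffices.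
  · have hka : k * a ≤ c := by
      rcases le_total 0 k with hk0 | hk0
      · nlinarith
      · nlinarith
    calc ρ * (r * d) ≤ ρ * (q * a) :=
          mul_le_mul_of_nonneg_left (mul_le_mul h.le (hrp h') hd0 (hr0.trans h.le)) hρ.le
      _ = X * a + Y * (k * a) := by rw [← mul_assoc, ← hbal]; ring
      _ ≤ X * a + Y * c := by
          have := mul_le_mul_of_nonneg_left hka hY
          linarith
  · have hk1 : 0 < 1 - k := by
      by_contra hcon
      nlinarith
    -- The mean bound with `c ≤ a` gives `μ - p ≤ (b - p) a`, and `hp` says `(μ - p) b = p (b - p)`.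
    have hab : p ≤ b * a := by
      have h1 : μ - p ≤ (b - p) * a := by nlinarith
      have h2 : p * (b - p) ≤ (b * a) * (b - p) := by nlinarith
      exact le_of_mul_le_mul_right h2 (by linarith)
    have hYk : Y * (1 - k) = ρ * (b - q) := by linarith
    have hXk : X * (1 - k) = ρ * (q - k * b) := by linear_combination hbal - k * htop
    have hmain : p * b * (1 - k) ≤ ((q - k * b) * a + (b - q) * c) * b := by
      -- Eliminating `c` by the mean bound leaves `μ - p + (p - k b) a`; inserting `a ≥ p / b` and
      -- `hp` gives exactly `p (1 - k)`.
      have h1 : (p - k * b) * p ≤ (p - k * b) * (b * a) :=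
        mul_le_mul_of_nonneg_left hab (by linarith)
      nlinarith
    have hfin : ρ * p * (1 - k) ≤ (X * a + Y * c) * (1 - k) := by
      have h1 : p * (1 - k) ≤ (q - k * b) * a + (b - q) * c :=
        le_of_mul_le_mul_right (by linarith) hb
      calc ρ * p * (1 - k) = ρ * (p * (1 - k)) := by ring
        _ ≤ ρ * ((q - k * b) * a + (b - q) * c) := mul_le_mul_of_nonneg_left h1 hρ.le
        _ = X * (1 - k) * a + Y * (1 - k) * c := by rw [hXk, hYk]; ring
        _ = (X * a + Y * c) * (1 - k) := by ring
    have hrd : r * d ≤ p := by nlinarith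
    exact (mul_le_mul_of_nonneg_left hrd hρ.le).trans (le_of_mul_le_mul_right hfin hk1)

/-! ### The normalised optimisation over the two prices -/

/-- The combination of the two worst-case inequalities which eliminates the probabilities. -/
lemma weighted_ratio_bound {P Q x y k n ρ : ℝ} (hPQ : P ≤ Q) (hkP : k * Q ≤ P)
    (hxy : x + y = 1)
    (hB : ρ * Q ≤ x * P + y * Q * k) (hC : ρ * (P * n) ≤ x * P + y * Q) :
    ρ * ((Q - P) * Q + (P - k * Q) * (P * n)) ≤ P * Q * (1 - k) := by
  have h1 := mul_le_mul_of_nonneg_left hB (sub_nonneg.2 hPQ)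
  have h2 := mul_le_mul_of_nonneg_left hC (sub_nonneg.2 hkP)
  have hy : y = 1 - x := by linarith
  subst hy
  nlinarith

lemma weighted_ratio_bound_strict {P Q x y k ρ : ℝ} (hPQ : P < Q) (hkP : k * Q ≤ P)
    (hxy : x + y = 1)
    (hB : ρ * Q < x * P + y * Q * k) (hC : ρ ≤ x * P + y * Q) :
    ρ * ((Q - P) * Q + (P - k * Q)) < P * Q * (1 - k) := by
  have h1 := mul_lt_mul_of_pos_left hB (sub_pos.2 hPQ)
  have h2 := mul_le_mul_of_nonneg_left hC (sub_nonneg.2 hkP)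
  have hy : y = 1 - x := by linarith
  subst hy
  nlinarith

/-- The hypothesis on `w` is the critical-point equation of the cubic divided by `Q`, hence the
double root at `w`. The last factor is positive for `w < 1` and `0 < Q ≤ 1`, so `w` is the minimiser
there. -/
lemma cubic_factor {t w Q M : ℝ} (hw : t * (1 + w) = 2 * w ^ 2) :
    (t * (1 - Q) ^ 2 + 2 * Q ^ 2 - Q ^ 3 - Q * M) * w * (1 + w)
      - Q * (t * (1 - w) ^ 2 + 2 * w ^ 2 - w ^ 3 - w * M) * (1 + w)
      = w * (Q - w) ^ 2 * (2 - Q * (1 + w)) := by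
  linear_combination (w * (1 - Q) ^ 2 - Q * (1 - w) ^ 2) * hw

/-- The normalised reciprocal of the ratio at lower price `t`, above the mean. -/
lemma high_regime_bound {t Q : ℝ} (ht : 0 ≤ t) :
    (2 * √t - t) * Q ≤ (Q - t) * Q + t := by
  nlinarith [sq_nonneg (Q - √t), Real.sq_sqrt ht]

lemma high_regime_eq {t Q : ℝ} (ht : 0 ≤ t) (h : (Q - t) * Q + t ≤ (2 * √t - t) * Q) :
    Q = √t := by
  have h0 : (Q - √t) ^ 2 ≤ 0 := by nlinarith [Real.sq_sqrt ht]
  have := pow_eq_zero_iff (two_ne_zero) |>.1 (le_antisymm h0 (sq_nonneg _))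
  linarith

lemma low_price_quartic_nonneg {t Q : ℝ} (ht : 0 ≤ t) (hQ0 : 0 < Q) :
    0 ≤ Q ^ 3 + 2 * t - 4 * t * Q + t ^ 2 * Q := by
  rcases le_total Q (1 / 2) with h | h
  · have h1 : 0 ≤ t * (1 - 2 * Q) := mul_nonneg ht (by linarith)
    have h2 : 0 ≤ t ^ 2 * Q := by positivity
    have h3 : 0 ≤ Q ^ 3 := by positivity
    nlinarith
  · have h1 : 0 ≤ (Q - 1) ^ 2 * (Q ^ 2 + 2 * Q - 1) :=
      mul_nonneg (sq_nonneg _) (by nlinarith)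
    -- The product equals `(Q t + 1 - 2 Q)² + (Q - 1)² (Q² + 2 Q - 1)`.
    have h2 : 0 ≤ Q * (Q ^ 3 + 2 * t - 4 * t * Q + t ^ 2 * Q) := by
      nlinarith [sq_nonneg (Q * t + 1 - 2 * Q)]
    exact nonneg_of_mul_nonneg_right h2 hQ0

/-- Below the mean, raising the lower price above `t` strictly increases the reciprocal ratio. -/
lemma raise_low_price {t M P Q : ℝ} (ht0 : 0 < t) (ht1 : t < 1) (hM : M = 2 * t - t ^ 2)
    (htP : t < P) (hPQ : P < Q) (hQM : Q < M) :
    P * (t * (1 - Q) ^ 2 + 2 * Q ^ 2 - Q ^ 3 - Q * M)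
      < t * ((Q - P) * Q * (1 - Q)
        + (P * (1 - Q) - (M - Q) * Q) * (P * ((1 - P) / (M - P)))) := by
  have hMP : 0 < M - P := by linarith
  have hM1 : M < 1 := by nlinarith [sq_pos_of_pos (sub_pos.2 ht1)]
  have hMt : 0 < M - t := by linarith
  have hQ0 : 0 < Q := by linarith
  have hP0 : 0 < P := by linarith
  -- `f` is what remains of the difference of the two sides after removing the factor `(P - t) / (M
  -- - P)`. It is concave quadratic in `z`, so positivity at `P` follows from its signs at `t` and
  -- `M`.
  set f : ℝ → ℝ := fun z => -Q ^ 2 * (1 - Q) * (M - z) + (1 - Q) * (2 - z - t) * z * t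
    - (M - Q) * Q * z * (1 - t) with hf
  have hft : 0 ≤ f t := by
    have h1 : f t = t * (1 - t) * (Q ^ 3 + 2 * t - 4 * t * Q + t ^ 2 * Q) := by
      simp only [hf]; rw [hM]; ring
    rw [h1]
    exact mul_nonneg (mul_nonneg ht0.le (by linarith))
      (low_price_quartic_nonneg ht0.le hQ0)
  have hfM : 0 < f M := by
    have h1 : f M = M * (1 - t) * (M - 2 * M * Q + Q ^ 2) := by
      simp only [hf]; rw [hM]; ring
    rw [h1]
    refine mul_pos (mul_pos (by linarith) (by linarith)) ?_
    nlinarith [sq_nonneg (Q - M)]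
  have hfP : 0 < f P := by
    -- Chord interpolation plus the concavity remainder.
    have h1 : f P * (M - t) = (M - P) * f t + (P - t) * f M
        + t * (1 - Q) * (M - t) * (P - t) * (M - P) := by
      simp only [hf]; ring
    have h2 : 0 ≤ (M - P) * f t := mul_nonneg hMP.le hft
    have h3 : 0 < (P - t) * f M := mul_pos (by linarith) hfM
    have h4 : 0 ≤ t * (1 - Q) * (M - t) * (P - t) * (M - P) :=
      mul_nonneg (mul_nonneg (mul_nonneg (mul_nonneg ht0.le (by linarith)) hMt.le)
        (by linarith)) hMP.le
    exact pos_of_mul_pos_left (by rw [h1]; linarith) hMt.le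
  have key : t * ((Q - P) * Q * (1 - Q)
        + (P * (1 - Q) - (M - Q) * Q) * (P * ((1 - P) / (M - P))))
      - P * (t * (1 - Q) ^ 2 + 2 * Q ^ 2 - Q ^ 3 - Q * M) = (P - t) * f P / (M - P) := by
    simp only [hf]
    field_simp
    rw [hM]
    ring
  have : 0 < (P - t) * f P / (M - P) := div_pos (mul_pos (by linarith) hfP) hMP
  linarith

lemma weighted_ratio_bound_strict_top {P Q x y k ρ : ℝ} (hPQ : P ≤ Q) (hkP : k * Q < P)
    (hxy : x + y = 1)
    (hB : ρ * Q ≤ x * P + y * Q * k) (hC : ρ < x * P + y * Q) :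
    ρ * ((Q - P) * Q + (P - k * Q)) < P * Q * (1 - k) := by
  have h1 := mul_le_mul_of_nonneg_left hB (sub_nonneg.2 hPQ)
  have h2 := mul_lt_mul_of_pos_left hC (sub_pos.2 hkP)
  have hy : y = 1 - x := by linarith
  subst hy
  nlinarith

lemma topMass_lt_low {t M P : ℝ} (ht0 : 0 < t) (ht1 : t < 1) (hM : M = 2 * t - t ^ 2)
    (htP : t < P) (hP : P ≤ 1) : topMass 1 M P < t := by
  refine max_lt ht0 ?_
  rcases hP.lt_or_eq with h | rfl
  · rw [div_lt_iff₀ (by linarith)]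
    nlinarith
  · simpa using ht0

lemma topMass_mul_lt {t M Q : ℝ} (ht0 : 0 < t) (ht1 : t < 1) (hM : M = 2 * t - t ^ 2)
    (htQ : t < Q) (hQ : Q ≤ 1) : topMass 1 M Q * Q < t :=
  (mul_le_of_le_one_right (topMass_nonneg _ _ _) hQ).trans_lt (topMass_lt_low ht0 ht1 hM htQ hQ)

/-- `H` stands for a lower bound on `t / ρ`. It is kept as a parameter so that both regimes use the
same estimates. -/
lemma cubic_lower_bound {t M w H Q : ℝ} (hw0 : 0 < w) (hw1 : w < 1)
    (hw : t * (1 + w) = 2 * w ^ 2) (hQ0 : 0 < Q) (hQ : Q ≤ 1)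
    (hlo : H * (1 - M) * w ≤ t * (1 - w) ^ 2 + 2 * w ^ 2 - w ^ 3 - w * M) :
    H * (1 - M) * Q ≤ t * (1 - Q) ^ 2 + 2 * Q ^ 2 - Q ^ 3 - Q * M ∧
      (H * (1 - M) * Q = t * (1 - Q) ^ 2 + 2 * Q ^ 2 - Q ^ 3 - Q * M →
        Q = w ∧ H * (1 - M) * w = t * (1 - w) ^ 2 + 2 * w ^ 2 - w ^ 3 - w * M) := by
  have hfac := cubic_factor (Q := Q) (M := M) hw
  have hpos : 0 < 2 - Q * (1 + w) := by nlinarith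
  have hnn : 0 ≤ w * (Q - w) ^ 2 * (2 - Q * (1 + w)) := by positivity
  have hw1' : 0 < w * (1 + w) := by positivity
  set N := t * (1 - Q) ^ 2 + 2 * Q ^ 2 - Q ^ 3 - Q * M
  set D := t * (1 - w) ^ 2 + 2 * w ^ 2 - w ^ 3 - w * M
  have h1 : H * (1 - M) * w * (Q * (1 + w)) ≤ D * (Q * (1 + w)) :=
    mul_le_mul_of_nonneg_right hlo (by positivity)
  refine ⟨le_of_mul_le_mul_right (by linarith) hw1', fun heq => ?_⟩
  have h2 : H * (1 - M) * w * (Q * (1 + w)) = N * w * (1 + w) := by rw [← heq]; ring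
  have h3 : w * (2 - Q * (1 + w)) * (Q - w) ^ 2 = 0 := by linarith
  have h4 : Q = w := by
    rcases mul_eq_zero.1 h3 with h | h
    · exact absurd h (by positivity)
    · linarith [pow_eq_zero_iff (two_ne_zero) |>.1 h]
  refine ⟨h4, ?_⟩
  have h5 : (H * (1 - M) * w - D) * (Q * (1 + w)) = 0 := by
    have : w * (Q - w) ^ 2 * (2 - Q * (1 + w)) = 0 := by rw [← h3]; ring
    linarith
  rcases mul_eq_zero.1 h5 with h | h
  · linarith
  · exact absurd h (by positivity)

lemma low_price_cost {t M w H Q : ℝ} (ht0 : 0 < t) (ht1 : t < 1) (hM : M = 2 * t - t ^ 2)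
    (hw0 : 0 < w) (hw1 : w < 1) (hw : t * (1 + w) = 2 * w ^ 2)
    (hhi : H ≤ 2 * √t - t)
    (hlo : H * (1 - M) * w ≤ t * (1 - w) ^ 2 + 2 * w ^ 2 - w ^ 3 - w * M)
    (htQ : t < Q) (hQ : Q ≤ 1) :
    H * (Q * (1 - topMass 1 M Q)) ≤ (Q - t) * Q + (t - topMass 1 M Q * Q) ∧
      (H * (Q * (1 - topMass 1 M Q)) = (Q - t) * Q + (t - topMass 1 M Q * Q) →
        (Q = √t ∧ H = 2 * √t - t) ∨
        (Q = w ∧ H * (1 - M) * w = t * (1 - w) ^ 2 + 2 * w ^ 2 - w ^ 3 - w * M)) := by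
  have hQ0 : 0 < Q := ht0.trans htQ
  have hM1 : M < 1 := by nlinarith [sq_pos_of_pos (sub_pos.2 ht1)]
  rcases le_or_gt M Q with h | h
  · rw [topMass_of_ge hQ h]
    have h1 := high_regime_bound (Q := Q) ht0.le
    have h2 : H * Q ≤ (2 * √t - t) * Q := mul_le_mul_of_nonneg_right hhi hQ0.le
    refine ⟨by linarith, fun heq => Or.inl ⟨high_regime_eq ht0.le (by linarith), ?_⟩⟩
    exact mul_right_cancel₀ hQ0.ne' (by linarith : H * Q = (2 * √t - t) * Q)
  · have h1Q : 0 < 1 - Q := by linarith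
    have hk : topMass 1 M Q * (1 - Q) = M - Q := by
      rw [topMass_of_le hM1.le h.le, div_mul_cancel₀ _ h1Q.ne']
    obtain ⟨h1, h2⟩ := cubic_lower_bound hw0 hw1 hw hQ0 hQ hlo
    set k := topMass 1 M Q
    have hl : H * (Q * (1 - k)) * (1 - Q) = H * (1 - M) * Q := by
      linear_combination -(H * Q) * hk
    have hr : ((Q - t) * Q + (t - k * Q)) * (1 - Q)
        = t * (1 - Q) ^ 2 + 2 * Q ^ 2 - Q ^ 3 - Q * M := by
      linear_combination -Q * hk
    refine ⟨le_of_mul_le_mul_right (by rw [hl, hr]; exact h1) h1Q, fun heq => Or.inr (h2 ?_)⟩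
    rw [← hl, ← hr, heq]

/-- A lower price above `t` is strictly suboptimal. -/
lemma ratio_lt_of_low_lt {t M w H P Q x y ρ : ℝ} (ht0 : 0 < t) (ht1 : t < 1)
    (hM : M = 2 * t - t ^ 2)
    (hw0 : 0 < w) (hw1 : w < 1) (hw : t * (1 + w) = 2 * w ^ 2)
    (hhi : H ≤ 2 * √t - t)
    (hlo : H * (1 - M) * w ≤ t * (1 - w) ^ 2 + 2 * w ^ 2 - w ^ 3 - w * M)
    (hρ : 0 < ρ) (htP : t < P) (hPQ : P < Q) (hQ : Q ≤ 1) (hPM : P < M) (hxy : x + y = 1)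
    (hB : ρ * Q ≤ x * P + y * Q * topMass 1 M Q)
    (hC : ρ * P ≤ topMass 1 M P * (x * P + y * Q)) : ρ * H < t := by
  have hP0 : 0 < P := ht0.trans htP
  have hQ0 : 0 < Q := hP0.trans hPQ
  have hM1 : M < 1 := by nlinarith [sq_pos_of_pos (sub_pos.2 ht1)]
  have hMP : 0 < M - P := by linarith
  have hkQ : topMass 1 M Q * Q ≤ P :=
    ((topMass_mul_lt ht0 ht1 hM (htP.trans hPQ) hQ).trans htP).le
  have hC' : ρ * (P * ((1 - P) / (M - P))) ≤ x * P + y * Q := by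
    rw [topMass_of_le hM1.le hPM.le, div_mul_eq_mul_div, le_div_iff₀ (by linarith)] at hC
    rw [← mul_assoc, mul_div_assoc', div_le_iff₀ hMP]
    linarith
  have hmain := weighted_ratio_bound hPQ.le hkQ hxy hB hC'
  rcases le_or_gt M Q with h | h
  · rw [topMass_of_ge hQ h, zero_mul, sub_zero, sub_zero, mul_one] at hmain
    set n := (1 - P) / (M - P) with hn
    have hn0 : 0 < n := div_pos (by linarith) hMP
    -- `n` is the reciprocal of the top mass at `P`, which is below `t` because `P > t`.
    have hnt : 1 < n * t := by
      rw [hn, div_mul_eq_mul_div, lt_div_iff₀ hMP]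
      nlinarith
    have hsn : 1 < √n * √t := by
      rw [← Real.sqrt_mul hn0.le]
      exact Real.lt_sqrt_of_sq_lt (by linarith)
    have h1 : (2 * √n - 1) * (P * Q) ≤ (Q - P) * Q + P * (P * n) := by
      have hPn : (P * √n) ^ 2 = P * (P * n) := by rw [mul_pow, Real.sq_sqrt hn0.le]; ring
      nlinarith [sq_nonneg (Q - P * √n)]
    have h2 : ρ * (2 * √n - 1) ≤ 1 := by
      refine le_of_mul_le_mul_right ?_ (mul_pos hP0 hQ0)
      have := mul_le_mul_of_nonneg_left h1 hρ.le
      linarith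
    have hst : 0 < √t := Real.sqrt_pos.2 ht0
    have h3 : 2 * √t - t < t * (2 * √n - 1) := by
      have : √t < t * √n := by
        calc √t = √t * 1 := (mul_one _).symm
          _ < √t * (√n * √t) := mul_lt_mul_of_pos_left hsn hst
          _ = t * √n := by rw [mul_left_comm, Real.mul_self_sqrt ht0.le]; ring
      linarith
    calc ρ * H ≤ ρ * (2 * √t - t) := mul_le_mul_of_nonneg_left hhi hρ.le
      _ < ρ * (t * (2 * √n - 1)) := mul_lt_mul_of_pos_left h3 hρ
      _ = t * (ρ * (2 * √n - 1)) := by ring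
      _ ≤ t * 1 := mul_le_mul_of_nonneg_left h2 ht0.le
      _ = t := mul_one t
  · have h1Q : 0 < 1 - Q := by linarith
    have hk : topMass 1 M Q * (1 - Q) = M - Q := by
      rw [topMass_of_le hM1.le h.le, div_mul_cancel₀ _ h1Q.ne']
    have h1 := (cubic_lower_bound hw0 hw1 hw hQ0 hQ hlo).1
    have h2 := raise_low_price ht0 ht1 hM htP hPQ h
    set n := (1 - P) / (M - P)
    set k := topMass 1 M Q
    set B := (Q - P) * Q * (1 - Q) + (P * (1 - Q) - (M - Q) * Q) * (P * n) with hBdef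
    have h3 : ρ * B ≤ P * Q * (1 - M) := by
      have e1 : ((Q - P) * Q + (P - k * Q) * (P * n)) * (1 - Q) = B := by
        rw [hBdef]; linear_combination -Q * (P * n) * hk
      have e2 : (1 - k) * (1 - Q) = 1 - M := by linarith
      calc ρ * B = ρ * ((Q - P) * Q + (P - k * Q) * (P * n)) * (1 - Q) := by rw [← e1]; ring
        _ ≤ P * Q * (1 - k) * (1 - Q) := mul_le_mul_of_nonneg_right hmain h1Q.le
        _ = P * Q * (1 - M) := by rw [mul_assoc, e2]
    have hpos : 0 < P * Q * (1 - M) := mul_pos (mul_pos hP0 hQ0) (by linarith)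
    refine lt_of_mul_lt_mul_right ?_ hpos.le
    calc ρ * H * (P * Q * (1 - M)) = ρ * (P * (H * (1 - M) * Q)) := by ring
      _ ≤ ρ * (P * (t * (1 - Q) ^ 2 + 2 * Q ^ 2 - Q ^ 3 - Q * M)) :=
          mul_le_mul_of_nonneg_left (mul_le_mul_of_nonneg_left h1 hP0.le) hρ.le
      _ < ρ * (t * B) := mul_lt_mul_of_pos_left h2 hρ
      _ = t * (ρ * B) := by ring
      _ ≤ t * (P * Q * (1 - M)) := mul_le_mul_of_nonneg_left h3 ht0.le

/-- The upper bound on the ratio of a two-level mechanism, in units of the largest valuation,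
together with its equality cases. -/
lemma two_level_bound {t M w H P Q x y ρ : ℝ} (ht0 : 0 < t) (ht1 : t < 1)
    (hM : M = 2 * t - t ^ 2)
    (hw0 : 0 < w) (hw1 : w < 1) (hw : t * (1 + w) = 2 * w ^ 2)
    (hH0 : 0 < H) (hH1 : H < 1) (hhi : H ≤ 2 * √t - t)
    (hlo : H * (1 - M) * w ≤ t * (1 - w) ^ 2 + 2 * w ^ 2 - w ^ 3 - w * M)
    (hP : 0 ≤ P) (hPQ : P ≤ Q) (hQ : Q ≤ 1) (hx : 0 ≤ x) (hxy : x + y = 1)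
    (hA : ρ ≤ x * P + y * Q)
    (hB : P < Q → ρ * Q ≤ x * P + y * Q * topMass 1 M Q)
    (hC : ρ * P ≤ topMass 1 M P * (x * P + y * Q)) :
    ρ * H ≤ t ∧ (ρ * H = t → P = t ∧ t < Q ∧ x * t + y * Q = ρ ∧
      ((Q = √t ∧ H = 2 * √t - t) ∨
        (Q = w ∧ H * (1 - M) * w = t * (1 - w) ^ 2 + 2 * w ^ 2 - w ^ 3 - w * M))) := by
  suffices hs : ρ * H < t ∨ (P = t ∧ t < Q ∧ x * t + y * Q = ρ ∧ ρ * H ≤ t ∧ (ρ * H = t →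
      ((Q = √t ∧ H = 2 * √t - t) ∨
        (Q = w ∧ H * (1 - M) * w = t * (1 - w) ^ 2 + 2 * w ^ 2 - w ^ 3 - w * M)))) by
    rcases hs with hs | ⟨h1, h2, h3, h4, h5⟩
    · exact ⟨hs.le, fun h => absurd h hs.ne⟩
    · exact ⟨h4, fun h => ⟨h1, h2, h3, h5 h⟩⟩
  rcases le_or_gt ρ t with hρt | hρt
  · left
    calc ρ * H ≤ t * H := mul_le_mul_of_nonneg_right hρt hH0.le
      _ < t * 1 := mul_lt_mul_of_pos_left hH1 ht0
      _ = t := mul_one t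
  have hρ : 0 < ρ := ht0.trans hρt
  have hAQ : x * P + y * Q ≤ Q := by
    have := mul_le_mul_of_nonneg_left hPQ hx
    nlinarith
  have htQ : t < Q := by linarith
  have hQ0 : 0 < Q := ht0.trans htQ
  have hk := topMass_lt_low ht0 ht1 hM htQ hQ
  have hkQ := topMass_mul_lt ht0 ht1 hM htQ hQ
  rcases hPQ.lt_or_eq with hlt | rfl
  swap
  -- Equal prices amount to a single price above `t`, so (C) gives `ρ < t`.
  · exfalso
    have h1 := topMass_lt_low ht0 ht1 hM htQ hQ
    have h2 : ρ * P ≤ topMass 1 M P * P := by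
      refine hC.trans_eq ?_
      rw [← add_mul, hxy, one_mul]
    have := le_of_mul_le_mul_right h2 hQ0
    linarith
  have hB' := hB hlt
  obtain ⟨hc1, hc2⟩ := low_price_cost ht0 ht1 hM hw0 hw1 hw hhi hlo htQ hQ
  set k := topMass 1 M Q with hkdef
  have hQk : 0 < Q * (1 - k) := mul_pos hQ0 (by linarith)
  have strict : ρ * ((Q - t) * Q + (t - k * Q)) < t * Q * (1 - k) → ρ * H < t := fun h => by
    refine lt_of_mul_lt_mul_right ?_ hQk.le
    have := mul_le_mul_of_nonneg_left hc1 hρ.le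
    linarith
  rcases lt_trichotomy P t with hPt | rfl | hPt
  · left
    -- Raising the lower price to `t` relaxes (A) and (B), strictly so once `x > 0`; and `x = 0`
    -- would turn (B) into `ρ ≤ k < t`.
    have hx0 : 0 < x := by
      refine hx.lt_of_ne fun h0 => ?_
      have hy1 : y = 1 := by linarith
      rw [← h0, hy1] at hB'
      have : ρ * Q ≤ k * Q := by linarith
      have := le_of_mul_le_mul_right this hQ0
      linarith
    have hxP : x * P < x * t := mul_lt_mul_of_pos_left hPt hx0
    exact strict (weighted_ratio_bound_strict htQ hkQ.le hxy (by linarith) (by linarith))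
  · rcases hA.lt_or_eq with hA' | hA'
    · exact Or.inl (strict (weighted_ratio_bound_strict_top htQ.le hkQ hxy hB' hA'))
    · right
      have hm := weighted_ratio_bound (n := 1 / P) htQ.le hkQ.le hxy hB'
        (by rw [mul_one_div_cancel ht0.ne', mul_one]; exact hA)
      rw [mul_one_div_cancel ht0.ne', mul_one] at hm
      have h1 := mul_le_mul_of_nonneg_left hc1 hρ.le
      refine ⟨rfl, htQ, hA'.symm, le_of_mul_le_mul_right (by linarith) hQk, fun heq => hc2 ?_⟩
      have h2 : ρ * (H * (Q * (1 - k))) = P * Q * (1 - k) := by rw [← mul_assoc, heq]; ring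
      exact mul_left_cancel₀ hρ.ne' (by linarith)
  · left
    have hPM : P < M := by
      by_contra hcon
      rw [topMass_of_ge (hPQ.trans hQ) (not_lt.1 hcon), zero_mul] at hC
      have := mul_pos hρ (ht0.trans hPt)
      linarith
    exact ratio_lt_of_low_lt ht0 ht1 hM hw0 hw1 hw hhi hlo hρ hPt hlt hQ hPM hxy hB' hC

/-! ### The threshold between the regimes -/

/-- The quintic whose root separates the two regimes. -/
def regimePoly (c : ℝ) : ℝ := -32 * c ^ 5 + 22 * c ^ 3 + 6 * c ^ 2 - 3 * c - 1

lemma regimePoly_lt {c d : ℝ} (hc : 1 / 2 ≤ c ^ 2) (hc0 : 0 < c) (hcd : c < d) :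
    regimePoly d < regimePoly c := by
  have hanti : StrictAntiOn regimePoly (Set.Icc c d) := by
    refine strictAntiOn_of_deriv_neg (convex_Icc c d) (by unfold regimePoly; fun_prop) ?_
    intro z hz
    rw [interior_Icc] at hz
    have hd : HasDerivAt regimePoly
        (-32 * (5 * z ^ 4) + 22 * (3 * z ^ 2) + 6 * (2 * z) - 3) z := by
      have h5 := (hasDerivAt_pow 5 z).const_mul (-32)
      have h3 := (hasDerivAt_pow 3 z).const_mul 22
      have h2 := (hasDerivAt_pow 2 z).const_mul 6
      have h1 := (hasDerivAt_id z).const_mul 3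
      refine ((((h5.add h3).add h2).sub h1).sub_const 1).congr_deriv ?_
      norm_num
    rw [hd.deriv]
    have hz2 : 1 / 2 ≤ z ^ 2 := by nlinarith [hz.1]
    -- The square gives `12 z ≤ 14 z² + 18/7`, which bounds the derivative by `-80 z² (2 z² - 1) -
    -- 3/7`.
    nlinarith [sq_nonneg (z - 6 / 14)]
  exact hanti ⟨le_rfl, hcd.le⟩ ⟨hcd.le, le_rfl⟩ hcd

/-- The normalised mean attached to the parameter `c`. -/
def regimeMean (c : ℝ) : ℝ := 1 - (1 - (2 * c - 1 / c) ^ 2) ^ 2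

lemma regimeMean_lt {c d : ℝ} (hc : 1 / 2 ≤ c ^ 2) (hc0 : 0 < c) (hcd : c < d) (hd : d ≤ 1) :
    regimeMean c < regimeMean d := by
  have hd0 : 0 < d := hc0.trans hcd
  have h1 : 0 ≤ 2 * c - 1 / c := by
    rw [sub_nonneg, div_le_iff₀ hc0]; nlinarith
  have h2 : 2 * c - 1 / c < 2 * d - 1 / d := by
    have := one_div_lt_one_div_of_lt hc0 hcd
    linarith
  have h3 : 2 * d - 1 / d ≤ 1 := by
    have : 1 ≤ 1 / d := by rw [le_div_iff₀ hd0]; linarith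
    linarith
  have h4 : (2 * c - 1 / c) ^ 2 < (2 * d - 1 / d) ^ 2 := by nlinarith
  have h5 : (2 * d - 1 / d) ^ 2 ≤ 1 := by nlinarith
  unfold regimeMean
  nlinarith

lemma exists_regime_root : ∃ c : ℝ, 0 < c ∧ 1 / 2 ≤ c ^ 2 ∧ c < 1 ∧ regimePoly c = 0 ∧
    0.4902 < regimeMean c ∧ regimeMean c < 0.4903 := by
  have hcont : ContinuousOn regimePoly (Set.Icc 0.853335 0.85335) := by
    unfold regimePoly; fun_prop
  obtain ⟨c, hc, hroot⟩ : (0 : ℝ) ∈ regimePoly '' Set.Icc 0.853335 0.85335 :=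
    intermediate_value_Icc' (by norm_num) hcont
      ⟨by norm_num [regimePoly], by norm_num [regimePoly]⟩
  have hc1 := hc.1
  have hc2 := hc.2
  have hc0 : 0 < c := by linarith
  have hsq : 1 / 2 ≤ c ^ 2 := by nlinarith
  refine ⟨c, hc0, hsq, by linarith, hroot, ?_, ?_⟩
  · have h : (0.4902 : ℝ) < regimeMean 0.853335 := by norm_num [regimeMean]
    rcases hc1.eq_or_lt with h' | h'
    · rwa [← h']
    · exact h.trans (regimeMean_lt (by norm_num) (by norm_num) h' (by linarith))
  · have h : regimeMean 0.85335 < (0.4903 : ℝ) := by norm_num [regimeMean]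
    rcases hc2.eq_or_lt with h' | h'
    · rwa [h']
    · exact (regimeMean_lt hsq hc0 h' (by norm_num)).trans h

/-! ### Upper bounds for mechanisms in the original units -/

lemma topMass_div {b μ p : ℝ} (hb : 0 < b) : topMass 1 (μ / b) (p / b) = topMass b μ p := by
  unfold topMass
  congr 1
  rw [← sub_div, one_sub_div hb.ne', div_div_div_cancel_right₀ hb.ne']

lemma LevelPricing.payment_two {b : ℝ} (m : LevelPricing 2 b) (v : ℝ) :
    m.payment v = (if m.price 0 ≤ v then m.prob 0 * m.price 0 else 0)
      + (if m.price 1 ≤ v then m.prob 1 * m.price 1 else 0) := by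
  rw [LevelPricing.payment, Fin.sum_univ_two]

lemma LevelPricing.price_zero_le_one {b : ℝ} (m : LevelPricing 2 b) : m.price 0 ≤ m.price 1 :=
  m.price_mono (by decide)

/-- Upper bound on the ratio of every two-level mechanism, with its equality cases. -/
lemma LevelPricing.ratio_two_bound {b μ t w H : ℝ} (m : LevelPricing 2 b)
    (hμ : 0 < μ) (hμb : μ < b)
    (ht0 : 0 < t) (ht1 : t < 1) (hM : μ / b = 2 * t - t ^ 2)
    (hw0 : 0 < w) (hw1 : w < 1) (hw : t * (1 + w) = 2 * w ^ 2)
    (hH0 : 0 < H) (hH1 : H < 1) (hhi : H ≤ 2 * √t - t)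
    (hlo : H * (1 - μ / b) * w ≤ t * (1 - w) ^ 2 + 2 * w ^ 2 - w ^ 3 - w * (μ / b)) :
    m.competitiveRatio μ * H ≤ t ∧ (m.competitiveRatio μ * H = t →
      m.price 0 / b = t ∧ t < m.price 1 / b ∧
      m.prob 0 * t + m.prob 1 * (m.price 1 / b) = m.competitiveRatio μ ∧
      ((m.price 1 / b = √t ∧ H = 2 * √t - t) ∨ (m.price 1 / b = w ∧
        H * (1 - μ / b) * w = t * (1 - w) ^ 2 + 2 * w ^ 2 - w ^ 3 - w * (μ / b)))) := by
  have hb : 0 < b := hμ.trans hμb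
  have hpq := m.price_zero_le_one
  have hp0 := (m.price_mem 0).1
  have hqb := (m.price_mem 1).2
  have htop : m.payment b = m.prob 0 * m.price 0 + m.prob 1 * m.price 1 := by
    rw [m.payment_top, Fin.sum_univ_two]
  have hA := m.ratio_mul_le_top hμ hμb
  rw [htop] at hA
  refine two_level_bound (P := m.price 0 / b) (x := m.prob 0) (y := m.prob 1) ht0 ht1 hM hw0 hw1
    hw hH0 hH1 hhi hlo (div_nonneg hp0 hb.le) (div_le_div_of_nonneg_right hpq hb.le)
    ((div_le_one hb).2 hqb) (m.prob_nonneg 0) (by simpa using m.prob_sum) ?_ ?_ ?_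
  · rw [mul_div_assoc', mul_div_assoc', ← add_div, le_div_iff₀ hb]
    exact hA
  · intro hlt
    have hlt' : m.price 0 < m.price 1 := (div_lt_div_iff_of_pos_right hb).1 hlt
    have h := m.ratio_mul_le_below (a := m.prob 0 * m.price 0) hμ hμb hp0 hlt' hqb
      fun r h1 h2 => by rw [m.payment_two, if_pos h1, if_neg (not_le.2 h2), add_zero]
    rw [topMass_div hb, mul_div_assoc', mul_div_assoc', mul_div_assoc', div_mul_eq_mul_div,
      ← add_div]
    refine div_le_div_of_nonneg_right (h.trans_eq ?_) hb.le
    rw [htop]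
    ring
  · rw [topMass_div hb, mul_div_assoc', mul_div_assoc', mul_div_assoc', ← add_div, mul_div_assoc']
    refine div_le_div_of_nonneg_right ?_ hb.le
    rcases hp0.eq_or_lt with h0 | h0
    · rw [← h0, mul_zero, mul_zero, zero_add]
      exact mul_nonneg (topMass_nonneg _ _ _)
        (mul_nonneg (m.prob_nonneg 1) (hp0.trans hpq))
    · have h := m.ratio_mul_le_below (a := 0) hμ hμb le_rfl h0 (hpq.trans hqb)
        fun r _ h2 => by
          rw [m.payment_two, if_neg (not_le.2 h2), if_neg (not_le.2 (h2.trans_le hpq)), add_zero]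
      rwa [mul_zero, zero_add, htop] at h

/-- Upper bounds on the ratio of a single price. -/
lemma LevelPricing.ratio_one_bounds {b μ : ℝ} (m : LevelPricing 1 b)
    (hμ : 0 < μ) (hμb : μ < b) :
    m.competitiveRatio μ ≤ m.price 0 / b ∧
      (0 < m.price 0 → m.competitiveRatio μ ≤ topMass b μ (m.price 0)) := by
  have hb : 0 < b := hμ.trans hμb
  have hx : m.prob 0 = 1 := by simpa using m.prob_sum
  have htop : m.payment b = m.price 0 := by
    rw [m.payment_top, Fin.sum_univ_one, hx, one_mul]
  have hA := m.ratio_mul_le_top hμ hμb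
  rw [htop] at hA
  refine ⟨(le_div_iff₀ hb).2 hA, fun h0 => ?_⟩
  have h := m.ratio_mul_le_below (a := 0) hμ hμb le_rfl h0 (m.price_mem 0).2
    fun r _ h2 => by rw [LevelPricing.payment, Fin.sum_univ_one, if_neg (not_le.2 h2)]
  rw [mul_zero, zero_add, htop] at h
  exact le_of_mul_le_mul_right h h0

/-! ### Optimality and uniqueness -/

/-- The unique optimal single price. -/
lemma one_level_optimal {b μ v : ℝ} (hμ : 0 < μ) (hμb : μ < b) (hv0 : 0 < v) (hvb : v < b)
    (hv : μ * b = 2 * v * b - v ^ 2) :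
    (∃ m : LevelPricing 1 b, m.price 0 = v) ∧
      ∀ m : LevelPricing 1 b, m.IsOptimal μ ↔ m.price 0 = v := by
  have hb : 0 < b := hμ.trans hμb
  have hM : μ / b = 2 * (v / b) - (v / b) ^ 2 := by
    field_simp
    linarith
  have ht0 : 0 < v / b := div_pos hv0 hb
  have ht1 : v / b < 1 := (div_lt_one hb).2 hvb
  have hlow : ∀ m : LevelPricing 1 b, m.price 0 = v → v / b ≤ m.competitiveRatio μ := by
    rintro m rfl
    exact m.le_ratio_one hμ hμb hv0 hvb hv
  have hup : ∀ m : LevelPricing 1 b, m.price 0 ≠ v → m.competitiveRatio μ < v / b := by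
    intro m hne
    obtain ⟨h1, h2⟩ := m.ratio_one_bounds hμ hμb
    rcases hne.lt_or_gt with h | h
    · exact h1.trans_lt (div_lt_div_of_pos_right h hb)
    · refine (h2 (hv0.trans h)).trans_lt ?_
      rw [← topMass_div hb]
      exact topMass_lt_low ht0 ht1 hM (div_lt_div_of_pos_right h hb)
        ((div_le_one hb).2 (m.price_mem 0).2)
  let m₀ : LevelPricing 1 b :=
    { price := fun _ => v
      prob := fun _ => 1
      price_mono := fun _ _ _ => le_rfl
      price_mem := fun _ => ⟨hv0.le, hvb.le⟩
      prob_nonneg := fun _ => zero_le_one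
      prob_sum := by simp }
  refine ⟨⟨m₀, rfl⟩, fun m => ⟨fun hm => ?_, fun hm m' => ?_⟩⟩
  · by_contra hne
    exact absurd ((hlow m₀ rfl).trans (hm m₀)) (not_le.2 (hup m hne))
  · refine le_trans ?_ (hlow m hm)
    rcases eq_or_ne (m'.price 0) v with h | h
    · have := (m'.ratio_one_bounds hμ hμb).1
      rwa [h] at this
    · exact (hup m' h).le

/-- A mechanism attaining a common upper bound is optimal. -/
lemma LevelPricing.optimal_of_bound {n : ℕ} {b μ ρ : ℝ} (m : LevelPricing n b)
    (hm : ρ ≤ m.competitiveRatio μ) (hub : ∀ m' : LevelPricing n b, m'.competitiveRatio μ ≤ ρ) :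
    m.IsOptimal μ ∧ m.competitiveRatio μ = ρ ∧ optimalRatio n b μ = ρ ∧
      ∀ m' : LevelPricing n b, m'.IsOptimal μ → m'.competitiveRatio μ = ρ := by
  have : Nonempty (LevelPricing n b) := ⟨m⟩
  refine ⟨fun m' => (hub m').trans hm, le_antisymm (hub m) hm, le_antisymm (ciSup_le hub) ?_,
    fun m' hm' => le_antisymm (hub m') (hm.trans (hm' m))⟩
  refine hm.trans (le_ciSup (f := fun m : LevelPricing n b => m.competitiveRatio μ) ⟨ρ, ?_⟩ m)
  rintro _ ⟨m', rfl⟩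
  exact hub m'

/-- Two-level mechanisms with the same prices and the same top payment coincide. -/
lemma LevelPricing.two_ext {b t Q ρ : ℝ} {m m' : LevelPricing 2 b} (h0 : m'.price 0 = m.price 0)
    (h1 : m'.price 1 = m.price 1) (htQ : t < Q)
    (hm : m.prob 0 * t + m.prob 1 * Q = ρ) (hm' : m'.prob 0 * t + m'.prob 1 * Q = ρ) :
    m' = m := by
  have hs : m.prob 0 + m.prob 1 = 1 := by simpa using m.prob_sum
  have hs' : m'.prob 0 + m'.prob 1 = 1 := by simpa using m'.prob_sum
  have hx : m'.prob 0 = m.prob 0 := by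
    have : (m'.prob 0 - m.prob 0) * (Q - t) = 0 := by
      rw [← eq_sub_iff_add_eq'] at hs hs'
      rw [hs] at hm
      rw [hs'] at hm'
      linear_combination hm - hm'
    rcases mul_eq_zero.1 this with h | h <;> linarith
  ext i <;> fin_cases i
  · exact h0
  · exact h1
  · exact hx
  · show m'.prob 1 = m.prob 1
    linarith

/-- The two-level mechanism with prices `p ≤ q` and probabilities `x`, `1 - x`. -/
def twoLevel {b p q x : ℝ} (hp : 0 ≤ p) (hpq : p ≤ q) (hq : q ≤ b) (hx0 : 0 ≤ x) (hx1 : x ≤ 1) :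
    LevelPricing 2 b where
  price := ![p, q]
  prob := ![x, 1 - x]
  price_mono := by
    intro i j h
    fin_cases i <;> fin_cases j <;> simp_all
  price_mem := by
    intro i
    fin_cases i
    · exact ⟨hp, hpq.trans hq⟩
    · exact ⟨hp.trans hpq, hq⟩
  prob_nonneg := by
    intro i
    fin_cases i
    · exact hx0
    · exact sub_nonneg.2 hx1
  prob_sum := by simp

/-! ### Rational parametrisation of the prices -/

lemma lowPrice_spec {b μ : ℝ} (hμ : 0 < μ) (hμb : μ < b) :
    0 < lowPrice b μ ∧ lowPrice b μ < b ∧ μ * b = 2 * lowPrice b μ * b - lowPrice b μ ^ 2 := by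
  have hb : 0 < b := hμ.trans hμb
  have hpos : 0 < b ^ 2 - μ * b := by nlinarith
  have h1 : 0 < √(b ^ 2 - μ * b) := Real.sqrt_pos.2 hpos
  have h2 : √(b ^ 2 - μ * b) < b := by
    rw [Real.sqrt_lt' hb]
    nlinarith
  have h3 := Real.sq_sqrt hpos.le
  unfold lowPrice
  refine ⟨by linarith, by linarith, by nlinarith⟩

/-- The parameter `c` with `√t = 2c - 1/c`. -/
lemma exists_regime_parameter {s : ℝ} (hs0 : 0 < s) (hs1 : s < 1) :
    ∃ c : ℝ, 0 < c ∧ 1 / 2 ≤ c ^ 2 ∧ c < 1 ∧ 2 * c ^ 2 = s * c + 1 := by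
  have h := Real.sq_sqrt (show (0 : ℝ) ≤ s ^ 2 + 8 by positivity)
  have h0 := Real.sqrt_nonneg (s ^ 2 + 8)
  have h3 : √(s ^ 2 + 8) < 3 := by
    rw [Real.sqrt_lt' (by norm_num)]
    nlinarith
  have hq : 2 * ((s + √(s ^ 2 + 8)) / 4) ^ 2 = s * ((s + √(s ^ 2 + 8)) / 4) + 1 := by nlinarith
  have hc0 : 0 < (s + √(s ^ 2 + 8)) / 4 := by linarith
  have := mul_pos hs0 hc0
  exact ⟨(s + √(s ^ 2 + 8)) / 4, hc0, by linarith, by linarith, hq⟩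

/-- Both candidate minima are rational in `c`, and all factors of their difference except the
quintic keep a positive sign. A nonnegative quintic thus makes `2√t - t` the smaller minimum. -/
lemma regime_comparison {c s M : ℝ} (hs0 : 0 < s) (hc0 : 0 < c) (hc1 : c < 1)
    (hs : 2 * c ^ 2 = s * c + 1) (hM : M = 2 * s ^ 2 - (s ^ 2) ^ 2) :
    ∃ a : ℝ, 0 < a ∧ s ^ 2 * (1 - s * c) ^ 2 + 2 * (s * c) ^ 2 - (s * c) ^ 3 - s * c * M
      - (2 * s - s ^ 2) * (1 - M) * (s * c) = a * regimePoly c := by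
  have h1 : 0 < 1 - c ^ 2 := by nlinarith
  have h2 : 0 < 1 - c := by linarith
  refine ⟨(s * c) ^ 2 * (1 - c ^ 2) ^ 2 * (1 - c) / c ^ 6, by positivity, ?_⟩
  have h : s = (2 * c ^ 2 - 1) / c := by
    rw [eq_div_iff hc0.ne']; linarith
  unfold regimePoly
  rw [hM, h]
  field_simp
  ring

lemma highPrice_eq {b μ s c : ℝ} (hb : 0 < b) (hs0 : 0 < s) (hc0 : 0 < c)
    (hsc : 2 * c ^ 2 = s * c + 1) (hv : lowPrice b μ = b * s ^ 2) (hc : s ≤ c) :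
    highPrice b μ = b * (s * c) := by
  have h : √(lowPrice b μ ^ 2 + 8 * lowPrice b μ * b) = 4 * (b * (s * c)) - lowPrice b μ := by
    rw [hv]
    refine Real.sqrt_eq_iff_mul_self_eq_of_pos ?_ |>.2 ?_
    · have h1 : s * s ≤ s * c := mul_le_mul_of_nonneg_left hc hs0.le
      have h2 : 0 < b * (s * c) := by positivity
      nlinarith
    · linear_combination (8 * b ^ 2 * s ^ 2) * hsc
  unfold highPrice
  rw [h]
  ring

/-- The mechanism of the first regime guarantees `s / (2 - s)`. -/
lemma high_mechanism_ratio {b μ s : ℝ} (m : LevelPricing 2 b) (hμ : 0 < μ) (hμb : μ < b)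
    (hs0 : 0 < s) (hs1 : s < 1)
    (h0 : m.price 0 = b * s ^ 2) (h1 : m.price 1 = b * s)
    (hv : μ * b = 2 * m.price 0 * b - m.price 0 ^ 2)
    (hx : m.prob 0 = 1 / (2 - s)) (hy : m.prob 1 = 1 - m.prob 0) :
    s / (2 - s) ≤ m.competitiveRatio μ := by
  have hb : 0 < b := hμ.trans hμb
  have h2s : 0 < 2 - s := by linarith
  refine m.le_ratio_two (k := 0) hμ hμb (by rw [h0]; positivity)
    (by rw [h1]; exact mul_lt_of_lt_one_right hb hs1) hv (fun F _ => measureReal_nonneg)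
    (by rw [h0, zero_mul]; positivity) (div_pos hs0 h2s) ?_ ?_
  · rw [hy, hx, h0, h1]
    field_simp
    ring
  · rw [hx, h0, h1]
    field_simp
    ring

/-- By `hv` the first quantity is `(b - v)² - (b - q)²`. The gap in the last inequality is `v (b -
q)²`, the numerator of the second probability. -/
lemma denom_pos {b μ v q : ℝ} (hμb : μ < b) (hv0 : 0 < v)
    (hv : μ * b = 2 * v * b - v ^ 2) (hvq : v < q) (hq : q < b) :
    0 < 2 * q * b - q ^ 2 - μ * b ∧ 0 < denom b μ v q ∧
      q * (2 * q * b - q ^ 2 - μ * b) ≤ denom b μ v q := by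
  have hb : 0 < b := by linarith
  have h1 : 0 < 2 * q * b - q ^ 2 - μ * b := by nlinarith
  have h2 : 0 < v * b * (b - μ) := mul_pos (mul_pos hv0 hb) (by linarith)
  have h3 := mul_pos (sub_pos.2 hvq) h1
  have h4 : 0 ≤ v * (b - q) ^ 2 := by positivity
  unfold denom
  exact ⟨h1, by linarith, by linarith⟩

/-- The mechanism of the second regime guarantees `v q (b - μ) / D`. -/
lemma low_mechanism_ratio {b μ v q : ℝ} (m : LevelPricing 2 b) (hμ : 0 < μ) (hμb : μ < b)
    (h0 : m.price 0 = v) (h1 : m.price 1 = q) (hv0 : 0 < v)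
    (hv : μ * b = 2 * v * b - v ^ 2) (hvq : v < q) (hq : q < b)
    (hx : m.prob 0 = q * (2 * q * b - q ^ 2 - μ * b) / denom b μ v q)
    (hy : m.prob 1 = 1 - m.prob 0) :
    v * q * (b - μ) / denom b μ v q ≤ m.competitiveRatio μ := by
  have hb : 0 < b := hμ.trans hμb
  obtain ⟨-, hD, -⟩ := denom_pos hμb hv0 hv hvq hq
  have hy' : m.prob 1 = v * (b - q) ^ 2 / denom b μ v q := by
    rw [hy, hx, eq_div_iff hD.ne', sub_mul, div_mul_cancel₀ _ hD.ne']
    unfold denom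
    ring
  have hbq : 0 < b - q := by linarith
  refine m.le_ratio_two (k := (μ - q) / (b - q)) hμ hμb (h0 ▸ hv0) (h1 ▸ hq) (by rw [h0]; exact hv)
    (fun F hF => by rw [h1]; exact tail_ge_of_mean hF hq) ?_
    (div_pos (mul_pos (mul_pos hv0 (by linarith)) (by linarith)) hD) ?_ ?_
  · rw [h0, div_mul_eq_mul_div, div_le_iff₀ hbq]
    nlinarith
  · rw [hy', hx, h0, h1]
    field_simp
    ring
  · rw [hy', hx, h0, h1]
    field_simp
    ring

/-- The data attached to the normalised square root `s` of the lower price. -/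
lemma regime_data {b μ v s c : ℝ} (hb : 0 < b) (hs0 : 0 < s) (hs1 : s < 1) (hv : v = b * s ^ 2)
    (hvq : μ * b = 2 * v * b - v ^ 2) (hc0 : 0 < c) (hc1 : c < 1) (hsc : 2 * c ^ 2 = s * c + 1) :
    μ / b = 2 * s ^ 2 - (s ^ 2) ^ 2 ∧ μ / b = regimeMean c ∧ s < c ∧ s * c < 1 ∧
      s ^ 2 * (1 + s * c) = 2 * (s * c) ^ 2 := by
  have hM : μ / b = 2 * s ^ 2 - (s ^ 2) ^ 2 := by
    rw [div_eq_iff hb.ne']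
    rw [hv] at hvq
    refine mul_right_cancel₀ hb.ne' (hvq.trans ?_)
    ring
  have hs : s = 2 * c - 1 / c := by
    field_simp
    linarith
  refine ⟨hM, ?_, ?_, by nlinarith, by
    linear_combination -s ^ 2 * hsc⟩
  · rw [hM, regimeMean, ← hs]
    ring
  · by_contra h
    nlinarith

/-! ### The two regimes -/

theorem high_regime {b μ v s c : ℝ} (hμ : 0 < μ) (hμb : μ < b) (hs0 : 0 < s) (hs1 : s < 1)
    (hv : v = b * s ^ 2) (hvq : μ * b = 2 * v * b - v ^ 2) (hc0 : 0 < c) (hc1 : c < 1)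
    (hsc : 2 * c ^ 2 = s * c + 1) (hg : 0 ≤ regimePoly c) :
    optimalRatio 2 b μ = s / (2 - s) ∧ ∃ m : LevelPricing 2 b,
      m.price 0 = v ∧ m.price 1 = b * s ∧ m.prob 0 = 1 / (2 - s) ∧ m.prob 1 = 1 - m.prob 0 ∧
      m.IsOptimal μ ∧ m.competitiveRatio μ = s / (2 - s) ∧
      (∀ m' : LevelPricing 2 b, m'.IsOptimal μ → m'.price 0 = v) ∧
      (0 < regimePoly c → ∀ m' : LevelPricing 2 b, m'.IsOptimal μ → m' = m) := by
  have hb : 0 < b := hμ.trans hμb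
  have hs2 : s ^ 2 < s := by
    rw [sq]
    exact mul_lt_of_lt_one_right hs0 hs1
  have hH1 : 2 * s - s ^ 2 < 1 := by
    have := sq_pos_of_pos (sub_pos.2 hs1)
    linarith only [this]
  have h2s : 0 < 2 - s := by linarith
  obtain ⟨hM, -, -, hw1, hw⟩ := regime_data hb hs0 hs1 hv hvq hc0 hc1 hsc
  obtain ⟨a, ha, hcmp⟩ := regime_comparison hs0 hc0 hc1 hsc hM
  have hlo := mul_nonneg ha.le hg
  rw [← hcmp] at hlo
  have hsqrt : √(s ^ 2) = s := Real.sqrt_sq hs0.le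
  have hH0 : 0 < 2 * s - s ^ 2 := by linarith only [hs2, hs0]
  -- Here `H` is the minimum at `√t`; `hlo` says that the minimum at `w` is no smaller.
  have hbound := fun m : LevelPricing 2 b => m.ratio_two_bound (t := s ^ 2) (w := s * c)
    (H := 2 * s - s ^ 2) hμ hμb (by positivity) (hs2.trans hs1) hM (by positivity) hw1 hw hH0
    hH1 (by rw [hsqrt]) (by linarith only [hlo])
  have hval : ∀ x : ℝ, x * (2 * s - s ^ 2) ≤ s ^ 2 → x ≤ s / (2 - s) := fun x hx => by
    rw [le_div_iff₀ h2s]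
    refine le_of_mul_le_mul_right ?_ hs0
    linarith
  have hval' : ∀ x : ℝ, x = s / (2 - s) → x * (2 * s - s ^ 2) = s ^ 2 := fun x hx => by
    rw [hx]
    field_simp
  obtain ⟨m, hm0, hm1, hm2, hm3⟩ : ∃ m : LevelPricing 2 b, m.price 0 = v ∧ m.price 1 = b * s ∧
      m.prob 0 = 1 / (2 - s) ∧ m.prob 1 = 1 - m.prob 0 :=
    ⟨twoLevel (p := v) (q := b * s) (x := 1 / (2 - s))
      (by rw [hv]; positivity) (by rw [hv]; exact mul_le_mul_of_nonneg_left hs2.le hb.le)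
      (mul_le_of_le_one_right hb.le hs1.le) (by positivity)
      (by rw [div_le_one h2s]; linarith), rfl, rfl, rfl, rfl⟩
  obtain ⟨h1, h2, h3, h4⟩ := m.optimal_of_bound
    (high_mechanism_ratio m hμ hμb hs0 hs1 (hm0.trans hv) hm1 (hm0 ▸ hvq) hm2 hm3)
    fun m' => hval _ (hbound m').1
  refine ⟨h3, m, hm0, hm1, hm2, hm3, h1, h2, fun m' hm' => ?_, fun hpos m' hm' => ?_⟩
  · have := ((hbound m').2 (hval' _ (h4 m' hm'))).1
    rw [div_eq_iff hb.ne'] at this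
    rw [this, hv, mul_comm]
  · obtain ⟨a1, a2, a3, a4⟩ := (hbound m').2 (hval' _ (h4 m' hm'))
    obtain ⟨-, -, b3, -⟩ := (hbound m).2 (hval' _ h2)
    have hq : m'.price 1 / b = s := by
      rcases a4 with a4 | a4
      · rw [a4.1, hsqrt]
      -- A positive quintic makes the minimum at `w` strictly larger, which rules out equality
      -- there.
      · have := mul_pos ha hpos
        linarith only [this, hcmp, a4.2]
    have hq' : m'.price 1 = m.price 1 := by
      rw [div_eq_iff hb.ne'] at hq
      rw [hq, mul_comm, hm1]
    rw [div_eq_iff hb.ne'] at a1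
    rw [h4 m' hm', hq'] at a3
    rw [h2] at b3
    rw [hq'] at a2
    refine LevelPricing.two_ext ?_ hq' a2 b3 a3
    rw [a1, mul_comm, hm0, hv]

theorem low_regime {b μ v s c : ℝ} (hμ : 0 < μ) (hμb : μ < b) (hs0 : 0 < s) (hs1 : s < 1)
    (hv : v = b * s ^ 2) (hvq : μ * b = 2 * v * b - v ^ 2) (hc0 : 0 < c) (hc1 : c < 1)
    (hsc : 2 * c ^ 2 = s * c + 1) (hg : regimePoly c ≤ 0) {q D : ℝ} (hq : q = b * (s * c))
    (hD : D = denom b μ v q) :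
    0 < D ∧ optimalRatio 2 b μ = v * q * (b - μ) / D ∧ ∃ m : LevelPricing 2 b,
      m.price 0 = v ∧ m.price 1 = q ∧ m.prob 0 = q * (2 * q * b - q ^ 2 - μ * b) / D ∧
      m.prob 1 = 1 - m.prob 0 ∧
      m.IsOptimal μ ∧ m.competitiveRatio μ = v * q * (b - μ) / D ∧
      (∀ m' : LevelPricing 2 b, m'.IsOptimal μ → m'.price 0 = v) ∧
      (regimePoly c < 0 → ∀ m' : LevelPricing 2 b, m'.IsOptimal μ → m' = m) := by
  have hb : 0 < b := hμ.trans hμb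
  have hs2 : s ^ 2 < s := by
    rw [sq]
    exact mul_lt_of_lt_one_right hs0 hs1
  have hH1 : 2 * s - s ^ 2 < 1 := by
    have := sq_pos_of_pos (sub_pos.2 hs1)
    linarith only [this]
  obtain ⟨hM, -, hsc', hw1, hw⟩ := regime_data hb hs0 hs1 hv hvq hc0 hc1 hsc
  obtain ⟨a, ha, hcmp⟩ := regime_comparison hs0 hc0 hc1 hsc hM
  have hv0 : 0 < v := by rw [hv]; positivity
  have hw0 : 0 < s * c := by positivity
  have hvlt : v < q := by
    rw [hv, hq]
    exact mul_lt_mul_of_pos_left (by rw [sq]; exact mul_lt_mul_of_pos_left hsc' hs0) hb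
  have hqb : q < b := by rw [hq]; exact mul_lt_of_lt_one_right hb hw1
  have hM1 : 0 < 1 - μ / b := sub_pos.2 ((div_lt_one hb).2 hμb)
  obtain ⟨hd1, hd2, hd3⟩ := denom_pos hμb hv0 hvq hvlt hqb
  rw [← hD] at hd2 hd3
  -- The denominator of the second regime is the cubic at `w = s c`, rescaled.
  have hDN : D = b ^ 3 * (s ^ 2 * (1 - s * c) ^ 2 + 2 * (s * c) ^ 2 - (s * c) ^ 3
      - s * c * (μ / b)) := by
    rw [hD, denom, hq, hv]
    field_simp
    ring
  set N := s ^ 2 * (1 - s * c) ^ 2 + 2 * (s * c) ^ 2 - (s * c) ^ 3 - s * c * (μ / b) with hN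
  have hN0 : 0 < N := pos_of_mul_pos_right (hDN ▸ hd2) (by positivity)
  have hden : 0 < (1 - μ / b) * (s * c) := mul_pos hM1 hw0
  have hle : N ≤ (2 * s - s ^ 2) * (1 - μ / b) * (s * c) := by
    have := mul_nonneg ha.le (neg_nonneg.2 hg)
    linarith only [this, hcmp]
  have hsqrt : √(s ^ 2) = s := Real.sqrt_sq hs0.le
  have hHle : N / ((1 - μ / b) * (s * c)) ≤ 2 * s - s ^ 2 := by
    rw [div_le_iff₀ hden]
    linarith
  have hHeq : N / ((1 - μ / b) * (s * c)) * (1 - μ / b) * (s * c) = N := by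
    rw [mul_assoc, div_mul_cancel₀ _ hden.ne']
  have hH0 : 0 < N / ((1 - μ / b) * (s * c)) := div_pos hN0 hden
  have hval : ∀ x : ℝ, x = v * q * (b - μ) / D → x * (N / ((1 - μ / b) * (s * c))) = s ^ 2 :=
    fun x hx => by
      have h1 : v * q * (b - μ) = b ^ 3 * s ^ 2 * ((1 - μ / b) * (s * c)) := by
        rw [hv, hq]
        field_simp
      rw [hx, h1, hDN, mul_assoc, mul_div_mul_left _ _ (by positivity : b ^ 3 ≠ 0),
        div_mul_div_comm, mul_assoc (s ^ 2), mul_comm N]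
      exact mul_div_cancel_right₀ _ (mul_pos hden hN0).ne'
  -- Now `H` is the minimum at `w`, which `hHle` places at or below the minimum at `√t`.
  have hbound := fun m : LevelPricing 2 b => m.ratio_two_bound (t := s ^ 2) (w := s * c)
    (H := N / ((1 - μ / b) * (s * c))) hμ hμb (by positivity) (hs2.trans hs1) hM hw0 hw1 hw hH0
    (hHle.trans_lt hH1) (by rw [hsqrt]; exact hHle) hHeq.le
  obtain ⟨m, hm0, hm1, hm2, hm3⟩ : ∃ m : LevelPricing 2 b, m.price 0 = v ∧ m.price 1 = q ∧
      m.prob 0 = q * (2 * q * b - q ^ 2 - μ * b) / D ∧ m.prob 1 = 1 - m.prob 0 :=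
    ⟨twoLevel (p := v) (q := q) (x := q * (2 * q * b - q ^ 2 - μ * b) / D) hv0.le hvlt.le hqb.le
      (div_nonneg (mul_nonneg (hv0.trans hvlt).le hd1.le) hd2.le) ((div_le_one hd2).2 hd3),
      rfl, rfl, rfl, rfl⟩
  obtain ⟨h1, h2, h3, h4⟩ := m.optimal_of_bound (ρ := v * q * (b - μ) / D)
    (hD ▸ low_mechanism_ratio m hμ hμb hm0 hm1 hv0 hvq hvlt hqb (hD ▸ hm2) hm3)
    fun m' => le_of_mul_le_mul_right ((hbound m').1.trans_eq (hval _ rfl).symm) hH0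
  refine ⟨hd2, h3, m, hm0, hm1, hm2, hm3, h1, h2, fun m' hm' => ?_, fun hneg m' hm' => ?_⟩
  · have := ((hbound m').2 (hval _ (h4 m' hm'))).1
    rw [div_eq_iff hb.ne'] at this
    rw [this, hv, mul_comm]
  · obtain ⟨a1, a2, a3, a4⟩ := (hbound m').2 (hval _ (h4 m' hm'))
    obtain ⟨-, -, b3, -⟩ := (hbound m).2 (hval _ h2)
    have hq1 : m'.price 1 / b = s * c := by
      rcases a4 with a4 | a4
      · exfalso
        rw [hsqrt, div_eq_iff hden.ne'] at a4
        have := mul_pos ha (neg_pos.2 hneg)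
        linarith only [this, hcmp, a4.2]
      · exact a4.1
    have hq' : m'.price 1 = m.price 1 := by
      rw [div_eq_iff hb.ne'] at hq1
      rw [hq1, mul_comm, hm1, hq]
    rw [div_eq_iff hb.ne'] at a1
    rw [h4 m' hm', hq'] at a3
    rw [h2] at b3
    rw [hq'] at a2
    refine LevelPricing.two_ext ?_ hq' a2 b3 a3
    rw [a1, mul_comm, hm0, hv]

end RobustPricing

end

open RobustPricing

theorem mainTheorem5 :
    ∃ τ : ℝ, 0.4902 < τ ∧ τ < 0.4903 ∧
      ∀ vbar μ v₁ : ℝ, 0 < μ → μ < vbar → v₁ = RobustPricing.lowPrice vbar μ →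
        -- `v₁` is the (unique) optimal price of 1-level pricing
        ((∃ m : RobustPricing.LevelPricing 1 vbar, m.price 0 = v₁) ∧
          ∀ m : RobustPricing.LevelPricing 1 vbar, m.IsOptimal μ ↔ m.price 0 = v₁) ∧
        -- every optimal 2-level mechanism has lower price `v₁`
        (∀ m : RobustPricing.LevelPricing 2 vbar, m.IsOptimal μ → m.price 0 = v₁) ∧
        -- first regime
        (μ / vbar ≤ τ →
          (∃ m : RobustPricing.LevelPricing 2 vbar,
            m.price 0 = v₁ ∧ m.price 1 = √(v₁ * vbar) ∧
            m.prob 0 = 1 / (2 - √(v₁ / vbar)) ∧ m.prob 1 = 1 - m.prob 0 ∧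
            m.IsOptimal μ ∧
            m.competitiveRatio μ = 1 / (2 * √(vbar / v₁) - 1) ∧
            (μ / vbar < τ →
              ∀ m' : RobustPricing.LevelPricing 2 vbar, m'.IsOptimal μ → m' = m)) ∧
          RobustPricing.optimalRatio 2 vbar μ = 1 / (2 * √(vbar / v₁) - 1)) ∧
        -- second regime
        (τ ≤ μ / vbar →
          ∀ v₂ D : ℝ, v₂ = RobustPricing.highPrice vbar μ →
            D = RobustPricing.denom vbar μ v₁ v₂ →
            0 < D ∧
            (∃ m : RobustPricing.LevelPricing 2 vbar,
              m.price 0 = v₁ ∧ m.price 1 = v₂ ∧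
              m.prob 0 = v₂ * (2 * v₂ * vbar - v₂ ^ 2 - μ * vbar) / D ∧
              m.prob 1 = 1 - m.prob 0 ∧
              m.IsOptimal μ ∧
              m.competitiveRatio μ = v₁ * v₂ * (vbar - μ) / D ∧
              (τ < μ / vbar →
                ∀ m' : RobustPricing.LevelPricing 2 vbar, m'.IsOptimal μ → m' = m)) ∧
            RobustPricing.optimalRatio 2 vbar μ = v₁ * v₂ * (vbar - μ) / D) := by
  obtain ⟨d, hd0, hd2, hd1, hroot, hτ1, hτ2⟩ := exists_regime_root
  refine ⟨regimeMean d, hτ1, hτ2, ?_⟩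
  rintro b μ v hμ hμb rfl
  have hb : 0 < b := hμ.trans hμb
  obtain ⟨hv0, hvb, hvq⟩ := lowPrice_spec hμ hμb
  obtain ⟨s, hs0, hs1, hv⟩ : ∃ s : ℝ, 0 < s ∧ s < 1 ∧ lowPrice b μ = b * s ^ 2 := by
    refine ⟨√(lowPrice b μ / b), Real.sqrt_pos.2 (div_pos hv0 hb), ?_, ?_⟩
    · rw [Real.sqrt_lt' one_pos, one_pow, div_lt_one hb]
      exact hvb
    · rw [Real.sq_sqrt (div_pos hv0 hb).le, mul_div_cancel₀ _ hb.ne']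
  obtain ⟨c, hc0, hc2, hc1, hsc⟩ := exists_regime_parameter hs0 hs1
  obtain ⟨-, hMc, hslt, -, -⟩ := regime_data hb hs0 hs1 hv hvq hc0 hc1 hsc
  -- `regimeMean` is increasing, so comparing `μ / b` with `τ` is comparing `c` with the root `d`;
  -- the quintic decreases through that root.
  have hcd : μ / b ≤ regimeMean d → c ≤ d := fun h => by
    by_contra hcon
    exact absurd (regimeMean_lt hd2 hd0 (not_le.1 hcon) hc1.le) (not_lt.2 (hMc ▸ h))
  have hdc : regimeMean d ≤ μ / b → d ≤ c := fun h => by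
    by_contra hcon
    exact absurd (regimeMean_lt hc2 hc0 (not_le.1 hcon) hd1.le) (not_lt.2 (hMc ▸ h))
  have hhigh : c ≤ d → 0 ≤ regimePoly c := fun h => by
    rcases h.eq_or_lt with rfl | h
    · exact hroot.ge
    · exact hroot ▸ (regimePoly_lt hc2 hc0 h).le
  have hlow : d ≤ c → regimePoly c ≤ 0 := fun h => by
    rcases h.eq_or_lt with rfl | h
    · exact hroot.le
    · exact hroot ▸ (regimePoly_lt hd2 hd0 h).le
  have hhp := highPrice_eq hb hs0 hc0 hsc hv hslt.le
  refine ⟨one_level_optimal hμ hμb hv0 hvb hvq, ?_, fun hle => ?_, fun hle q D hq hD => ?_⟩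
  · rcases le_total c d with h | h
    · obtain ⟨-, m, -, -, -, -, -, -, h7, -⟩ :=
        high_regime hμ hμb hs0 hs1 hv hvq hc0 hc1 hsc (hhigh h)
      exact h7
    · obtain ⟨-, -, m, -, -, -, -, -, -, h7, -⟩ :=
        low_regime hμ hμb hs0 hs1 hv hvq hc0 hc1 hsc (hlow h) rfl rfl
      exact h7
  · obtain ⟨h0, m, h1, h2, h3, h4, h5, h6, -, h8⟩ :=
      high_regime hμ hμb hs0 hs1 hv hvq hc0 hc1 hsc (hhigh (hcd hle))
    have e1 : √(lowPrice b μ * b) = b * s := by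
      rw [hv, show b * s ^ 2 * b = (b * s) ^ 2 by ring, Real.sqrt_sq (by positivity)]
    have e2 : √(lowPrice b μ / b) = s := by
      rw [hv, mul_div_cancel_left₀ _ hb.ne', Real.sqrt_sq hs0.le]
    have e3 : √(b / lowPrice b μ) = 1 / s := by
      rw [← inv_div, Real.sqrt_inv, e2, one_div]
    have e4 : 1 / (2 * (1 / s) - 1) = s / (2 - s) := by
      rw [show 2 * (1 / s) - 1 = (2 - s) / s by field_simp, one_div_div]
    rw [e1, e2, e3, e4]
    refine ⟨⟨m, h1, h2, h3, h4, h5, h6, fun hlt => h8 ?_⟩, h0⟩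
    have hne : c ≠ d := by
      rintro rfl
      exact hlt.ne hMc
    exact hroot ▸ regimePoly_lt hc2 hc0 ((hcd hle).lt_of_ne hne)
  · obtain ⟨h', h0, m, h1, h2, h3, h4, h5, h6, -, h8⟩ :=
      low_regime hμ hμb hs0 hs1 hv hvq hc0 hc1 hsc (hlow (hdc hle)) (hq.trans hhp) hD
    refine ⟨h', ⟨m, h1, h2, h3, h4, h5, h6, fun hlt => h8 ?_⟩, h0⟩
    have hne : d ≠ c := by
      rintro rfl
      exact hlt.ne' hMc
    exact hroot ▸ regimePoly_lt hd2 hd0 ((hdc hle).lt_of_ne hne)
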